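/- Let $F$ be a field. For $i=1,2$, let $a_i, m_i \geq 2$ be integers, let $V_i$ be a vector bundle of rank $m_i$ over the projective space $\mathbb{P}^{a_i-1}_F$, and let $\mathbb{P}(V_i) \to \mathbb{P}^{a_i-1}_F$ be the corresponding projective bundle (of lines in $V_i$). Assume that $a_1 \neq a_2$ and that $\mathbb{P}(V_1)$ and $\mathbb{P}(V_2)$ are isomorphic as $F$-varieties, i.e. as schemes over $\operatorname{Spec} F$. Then $m_1 = a_2$ and $m_2 = a_1$. -/

import Mathlib

universe u

namespace ProjectiveBundle

open CategoryTheory Limits AlgebraicGeometry MvPolynomial HomogeneousLocalization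

noncomputable section

attribute [local instance] MvPolynomial.gradedAlgebra

/-- `ℙ^{n-1}_A = Proj A[x₁, …, xₙ]`, the projective space with `n` homogeneous coordinates. -/
abbrev projSpace (n : ℕ) (A : CommRingCat.{u}) : Scheme.{u} :=
  Proj (homogeneousSubmodule (Fin n) A)

/-- The structure morphism `ℙ^{n-1}_A ⟶ Spec A`. -/
def projSpaceToSpec (n : ℕ) (A : CommRingCat.{u}) : projSpace n A ⟶ Spec A :=
  Proj.toSpecZero (homogeneousSubmodule (Fin n) A) ≫
    Spec.map (CommRingCat.ofHom (algebraMap A (homogeneousSubmodule (Fin n) A 0)))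

/-- The graded ring homomorphism `A[x] → B[y]` extending `φ : A → B` and sending `x_j` to
`∑_k M_{jk} y_k`. -/
def linSubst {n : ℕ} {A B : CommRingCat.{u}} (φ : A ⟶ B) (M : Matrix (Fin n) (Fin n) B) :
    GradedRingHom (homogeneousSubmodule (Fin n) A) (homogeneousSubmodule (Fin n) B) where
  toRingHom := eval₂Hom (C.comp φ.hom) fun j ↦ ∑ k, C (M j k) * X k
  map_mem {i p} hp := by
    rw [mem_homogeneousSubmodule] at hp ⊢
    have := hp.eval₂ (n := 1) (C.comp φ.hom) (fun j ↦ ∑ k, C (M j k) * X (R := B) k)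
      (fun r ↦ isHomogeneous_C _ _)
      (fun j ↦ IsHomogeneous.sum _ _ _ fun k _ ↦ (isHomogeneous_X B k).C_mul (M j k))
    rwa [one_mul] at this

lemma linSubst_C {n : ℕ} {A B : CommRingCat.{u}} (φ : A ⟶ B) (M : Matrix (Fin n) (Fin n) B)
    (a : A) : linSubst φ M (C a) = C (φ.hom a) :=
  eval₂Hom_C _ _ _

lemma linSubst_X {n : ℕ} {A B : CommRingCat.{u}} (φ : A ⟶ B) (M : Matrix (Fin n) (Fin n) B)
    (j : Fin n) : linSubst φ M (X j) = ∑ k, C (M j k) * X k :=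
  eval₂Hom_X' _ _ _

lemma linSubst_id {n : ℕ} {A : CommRingCat.{u}} :
    linSubst (𝟙 A) (1 : Matrix (Fin n) (Fin n) A) = .id _ := by
  refine GradedRingHom.ext fun p ↦ DFunLike.congr_fun (F := _ →+* _) (?_ : (linSubst (𝟙 A) (1 : Matrix (Fin n) (Fin n) A)).toRingHom
    = RingHom.id _) p
  refine MvPolynomial.ringHom_ext (fun a ↦ linSubst_C _ _ _) fun j ↦ ?_
  refine (linSubst_X _ _ _).trans ?_
  simp [Matrix.one_apply]

lemma linSubst_comp {n : ℕ} {A B D : CommRingCat.{u}} (φ : A ⟶ B) (ψ : B ⟶ D)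
    (M : Matrix (Fin n) (Fin n) B) (N : Matrix (Fin n) (Fin n) D) :
    (linSubst ψ N).comp (linSubst φ M) = linSubst (φ ≫ ψ) (M.map ψ.hom * N) := by
  refine GradedRingHom.ext fun p ↦ DFunLike.congr_fun (F := _ →+* _) (?_ : (linSubst ψ N).toRingHom.comp (linSubst φ M).toRingHom
    = (linSubst (φ ≫ ψ) (M.map ψ.hom * N)).toRingHom) p
  refine MvPolynomial.ringHom_ext (fun a ↦ ?_) fun j ↦ ?_
  · change linSubst ψ N (linSubst φ M (C a)) = linSubst (φ ≫ ψ) (M.map ψ.hom * N) (C a)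
    simp [linSubst_C]
  · change linSubst ψ N (linSubst φ M (X j)) = linSubst (φ ≫ ψ) (M.map ψ.hom * N) (X j)
    simp only [linSubst_X, map_sum, map_mul, linSubst_C, Matrix.mul_apply, Matrix.map_apply,
      Finset.mul_sum, Finset.sum_mul]
    rw [Finset.sum_comm]
    simp [mul_assoc]

lemma irrelevant_le_span {n : ℕ} {A : CommRingCat.{u}} :
    (HomogeneousIdeal.irrelevant (homogeneousSubmodule (Fin n) A)).toIdeal ≤
      Ideal.span (Set.range (X : Fin n → MvPolynomial (Fin n) A)) := by
  rw [HomogeneousIdeal.toIdeal_irrelevant_le]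
  intro i hi p hp
  change p ∈ Ideal.span _
  replace hp : p ∈ homogeneousSubmodule (Fin n) A i := hp
  rw [mem_homogeneousSubmodule] at hp
  rw [← Set.image_univ, mem_ideal_span_X_image]
  intro d hd
  have := hp (mem_support_iff.mp hd)
  by_contra! h
  have h0 : d = 0 := by ext j; simpa using h j
  subst h0
  simp at this
  omega

lemma irrelevant_le_map {n : ℕ} {A B : CommRingCat.{u}} (φ : A ⟶ B)
    {M : Matrix (Fin n) (Fin n) B} (hM : IsUnit M) :
    HomogeneousIdeal.irrelevant (homogeneousSubmodule (Fin n) B) ≤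
      (HomogeneousIdeal.irrelevant (homogeneousSubmodule (Fin n) A)).map (linSubst φ M) := by
  obtain ⟨N, hN⟩ := hM.exists_left_inv
  change HomogeneousIdeal.toIdeal _ ≤ HomogeneousIdeal.toIdeal _
  refine irrelevant_le_span.trans (Ideal.span_le.mpr ?_)
  rintro _ ⟨l, rfl⟩
  have h : (X l : MvPolynomial (Fin n) B) = ∑ j, C (N l j) * linSubst φ M (X j) := by
    simp only [linSubst_X, Finset.mul_sum, ← mul_assoc, ← C_mul]
    rw [Finset.sum_comm]
    simp only [← Finset.sum_mul, ← map_sum, ← Matrix.mul_apply, hN]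
    simp [Matrix.one_apply]
  rw [h]
  refine Ideal.sum_mem _ fun j _ ↦ Ideal.mul_mem_left _ _ ?_
  refine Ideal.mem_map_of_mem _ ?_
  exact HomogeneousIdeal.mem_irrelevant_of_mem _ one_pos (isHomogeneous_X A j)

/-- The morphism `ℙ^{n-1}_B ⟶ ℙ^{n-1}_A` given on homogeneous coordinates by `x_j = ∑_k M_{jk} y_k`,
where `M` is an invertible matrix over `B`. -/
def projSpaceMap {n : ℕ} {A B : CommRingCat.{u}} (φ : A ⟶ B)
    (M : Matrix (Fin n) (Fin n) B) (hM : IsUnit M) : projSpace n B ⟶ projSpace n A :=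
  Proj.map (linSubst φ M) (irrelevant_le_map φ hM)

/-! ### Base change -/

section BaseChange

variable {n : ℕ} {A B : CommRingCat.{u}}

lemma X_mem (i : Fin n) : (X i : MvPolynomial (Fin n) A) ∈ homogeneousSubmodule (Fin n) A 1 :=
  isHomogeneous_X A i

/-- The structure homomorphism of the degree zero localization `A[x]_{(s)}`. -/
def awayStr (s : MvPolynomial (Fin n) A) :
    A →+* Away (homogeneousSubmodule (Fin n) A) s :=
  (fromZeroRingHom (homogeneousSubmodule (Fin n) A) (Submonoid.powers s)).comp
    (algebraMap A (homogeneousSubmodule (Fin n) A 0))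

/-- The fraction `x_j / s` for a linear form `s`. -/
def awayFrac {s : MvPolynomial (Fin n) A} (hs : s ∈ homogeneousSubmodule (Fin n) A 1) (j : Fin n) :
    Away (homogeneousSubmodule (Fin n) A) s :=
  Away.mk _ hs 1 (X j) (X_mem j)

lemma val_awayFrac {s : MvPolynomial (Fin n) A} (hs : s ∈ homogeneousSubmodule (Fin n) A 1)
    (j : Fin n) : algebraMap (MvPolynomial (Fin n) A) (Localization.Away s) (X j) =
      algebraMap (MvPolynomial (Fin n) A) (Localization.Away s) s * (awayFrac hs j).val := by
  rw [awayFrac, Away.val_mk, Localization.mk_eq_mk', mul_comm]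
  simpa only [pow_one] using (IsLocalization.mk'_spec (M := Submonoid.powers s)
    (Localization.Away s) (X j) ⟨s ^ 1, 1, rfl⟩).symm

lemma val_awayStr (s : MvPolynomial (Fin n) A) (a : A) :
    (awayStr s a).val = algebraMap (MvPolynomial (Fin n) A) (Localization.Away s) (C a) :=
  Localization.mk_one_eq_algebraMap _

lemma away_mk_eq {s : MvPolynomial (Fin n) A} (hs : s ∈ homogeneousSubmodule (Fin n) A 1)
    (m : ℕ) (p : MvPolynomial (Fin n) A) (hp : p ∈ homogeneousSubmodule (Fin n) A (m • 1)) :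
    Away.mk _ hs m p hp = eval₂Hom (awayStr s) (awayFrac hs) p := by
  have hp' : p.IsHomogeneous m := by simpa using hp
  let L : MvPolynomial (Fin n) A →+* Localization.Away s := algebraMap _ _
  let v : Away (homogeneousSubmodule (Fin n) A) s →+* Localization.Away s := algebraMap _ _
  have hX (j) : L (X j) = L s * v (awayFrac hs j) := val_awayFrac hs j
  have hC (a) : L (C a) = v (awayStr s a) := (val_awayStr s a).symm
  have key : L p = L s ^ m * v (eval₂Hom (awayStr s) (awayFrac hs) p) := by
    rw [p.as_sum]
    simp only [map_sum, Finset.mul_sum]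
    refine Finset.sum_congr rfl fun d hd ↦ ?_
    have hdeg : ∑ j, d j = m := by
      have := hp' (mem_support_iff.mp hd)
      rw [Finsupp.weight_apply, Finsupp.sum_fintype _ _ (by simp)] at this
      simpa using! this
    rw [eval₂Hom_monomial, monomial_eq, map_mul, map_mul, hC, Finsupp.prod_fintype _ _ (by simp),
      Finsupp.prod_fintype _ _ (by simp), map_prod, map_prod]
    simp only [map_pow, hX, mul_pow, Finset.prod_mul_distrib, Finset.prod_pow_eq_pow_sum, hdeg]
    ring
  apply val_injective
  rw [Away.val_mk, Localization.mk_eq_mk', IsLocalization.mk'_eq_iff_eq_mul]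
  change L p = v _ * L (s ^ m)
  rw [key, map_pow, mul_comm]

lemma away_hom_ext {s : MvPolynomial (Fin n) A} (hs : s ∈ homogeneousSubmodule (Fin n) A 1)
    {R : Type*} [CommRing R] {f g : Away (homogeneousSubmodule (Fin n) A) s →+* R}
    (h₁ : ∀ a, f (awayStr s a) = g (awayStr s a))
    (h₂ : ∀ j, f (awayFrac hs j) = g (awayFrac hs j)) : f = g := by
  ext x
  obtain ⟨m, p, hp, rfl⟩ := Away.mk_surjective _ hs x
  rw [away_mk_eq]
  have : f.comp (eval₂Hom (awayStr s) (awayFrac hs)) = g.comp (eval₂Hom (awayStr s) (awayFrac hs)) :=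
    MvPolynomial.ringHom_ext (by simpa using h₁) (by simpa using h₂)
  exact congr($this p)

lemma exists_away_hom {s : MvPolynomial (Fin n) A} (hs : s ∈ homogeneousSubmodule (Fin n) A 1)
    {R : Type*} [CommRing R] (ψ : A →+* R) (r : Fin n → R) (h : eval₂Hom ψ r s = 1) :
    ∃ f : Away (homogeneousSubmodule (Fin n) A) s →+* R,
      (∀ a, f (awayStr s a) = ψ a) ∧ ∀ j, f (awayFrac hs j) = r j := by
  have hu : IsUnit (eval₂Hom ψ r s) := by rw [h]; exact isUnit_one
  let l : Localization.Away s →+* R := IsLocalization.Away.lift s hu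
  refine ⟨l.comp (algebraMap (Away (homogeneousSubmodule (Fin n) A) s) _), fun a ↦ ?_, fun j ↦ ?_⟩
  · change l (awayStr s a).val = _
    rw [val_awayStr, IsLocalization.Away.lift_eq, coe_eval₂Hom, eval₂_C]
  · change l (awayFrac hs j).val = _
    have := congr_arg l (val_awayFrac hs j)
    rw [map_mul, IsLocalization.Away.lift_eq, IsLocalization.Away.lift_eq, h, one_mul] at this
    rw [← this, coe_eval₂Hom, eval₂_X]

lemma map_awayStr (φ : A ⟶ B) (M : Matrix (Fin n) (Fin n) B) (s : MvPolynomial (Fin n) A) (a : A) :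
    Away.map (linSubst φ M) s (awayStr s a) = awayStr (linSubst φ M s) (φ.hom a) := by
  ext
  change Localization.mk (linSubst φ M (C a)) ⟨linSubst φ M 1, _⟩ = Localization.mk _ _
  congr 1
  · exact linSubst_C φ M a
  · ext1; exact map_one (linSubst φ M)

lemma map_awayFrac (φ : A ⟶ B) {s : MvPolynomial (Fin n) A}
    (hs : s ∈ homogeneousSubmodule (Fin n) A 1)
    (hs' : linSubst φ (1 : Matrix (Fin n) (Fin n) B) s ∈ homogeneousSubmodule (Fin n) B 1)
    (j : Fin n) :
    Away.map (linSubst φ (1 : Matrix (Fin n) (Fin n) B)) s (awayFrac hs j) = awayFrac hs' j := by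
  rw [awayFrac, Away.map_mk]
  have : linSubst φ (1 : Matrix (Fin n) (Fin n) B) (X j) = X j := by
    rw [linSubst_X]; simp [Matrix.one_apply]
  simp only [this]
  rfl

lemma isPushout_away (φ : A ⟶ B) (i : Fin n) :
    IsPushout φ (CommRingCat.ofHom (awayStr (X i : MvPolynomial (Fin n) A)))
      (CommRingCat.ofHom (awayStr (linSubst φ (1 : Matrix (Fin n) (Fin n) B) (X i))))
      (CommRingCat.ofHom (Away.map (linSubst φ (1 : Matrix (Fin n) (Fin n) B)) (X i))) := by
  have hs' : linSubst φ (1 : Matrix (Fin n) (Fin n) B) (X i) ∈ homogeneousSubmodule (Fin n) B 1 :=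
    (linSubst φ 1).map_mem (X_mem i)
  have hX : linSubst φ (1 : Matrix (Fin n) (Fin n) B) (X i) = X i := by
    rw [linSubst_X]; simp [Matrix.one_apply]
  have h1 : awayFrac (X_mem (A := A) i) i = 1 := by
    ext
    rw [awayFrac, Away.val_mk, val_one]
    simp only [pow_one]
    exact Localization.mk_self
      (⟨X i, 1, pow_one _⟩ : Submonoid.powers (X i : MvPolynomial (Fin n) A))
  have H (c : PushoutCocone φ (CommRingCat.ofHom (awayStr (X i : MvPolynomial (Fin n) A)))) :=
    exists_away_hom hs' c.inl.hom (fun j ↦ c.inr.hom (awayFrac (X_mem i) j))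
      (by rw [hX, coe_eval₂Hom, eval₂_X, h1, map_one])
  choose f hf₁ hf₂ using H
  refine ⟨⟨?_⟩, ⟨PushoutCocone.IsColimit.mk _ (fun c ↦ CommRingCat.ofHom (f c)) ?_ ?_ ?_⟩⟩
  · ext a
    exact congr_arg val (map_awayStr φ 1 (X i) a).symm
  · intro c
    ext b
    exact hf₁ c b
  · intro c
    ext1
    refine away_hom_ext (X_mem i) (fun a ↦ ?_) fun j ↦ ?_
    · change f c (Away.map (linSubst φ 1) (X i) (awayStr (X i) a)) = _
      rw [map_awayStr, hf₁]
      exact congr($(c.condition).hom a)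
    · change f c (Away.map (linSubst φ 1) (X i) (awayFrac (X_mem i) j)) = _
      rw [map_awayFrac φ (X_mem i) hs']
      exact hf₂ c j
  · intro c m h₁ h₂
    ext1
    refine away_hom_ext hs' (fun b ↦ ?_) fun j ↦ ?_
    · exact Eq.trans congr($(h₁).hom b) (hf₁ c b).symm
    · refine Eq.trans ?_ (hf₂ c j).symm
      rw [← map_awayFrac φ (X_mem i) hs']
      exact congr($(h₂).hom _)

lemma awayι_projSpaceToSpec {s : MvPolynomial (Fin n) A} {d : ℕ}
    (hs : s ∈ homogeneousSubmodule (Fin n) A d) (hd : 0 < d) :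
    Proj.awayι (homogeneousSubmodule (Fin n) A) s hs hd ≫ projSpaceToSpec n A =
      Spec.map (CommRingCat.ofHom (awayStr s)) := by
  rw [projSpaceToSpec, Proj.awayι_toSpecZero_assoc, ← Spec.map_comp]
  rfl

lemma awayι_projSpaceMap_toSpec (φ : A ⟶ B) (M : Matrix (Fin n) (Fin n) B) (hM : IsUnit M)
    {s : MvPolynomial (Fin n) A} {d : ℕ} (hs : s ∈ homogeneousSubmodule (Fin n) A d) (hd : 0 < d)
    (hs' : linSubst φ M s ∈ homogeneousSubmodule (Fin n) B d) :
    Proj.awayι (homogeneousSubmodule (Fin n) B) (linSubst φ M s) hs' hd ≫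
        projSpaceMap φ M hM ≫ projSpaceToSpec n A =
      Proj.awayι (homogeneousSubmodule (Fin n) B) (linSubst φ M s) hs' hd ≫
        projSpaceToSpec n B ≫ Spec.map φ := by
  rw [projSpaceMap, Proj.awayι_comp_map_assoc (linSubst φ M) _ hd _ hs, awayι_projSpaceToSpec,
    ← Category.assoc, awayι_projSpaceToSpec, ← Spec.map_comp, ← Spec.map_comp]
  congr 1
  ext a
  exact congr_arg val (map_awayStr φ M s a)

lemma projSpaceMap_toSpec (φ : A ⟶ B) (M : Matrix (Fin n) (Fin n) B) (hM : IsUnit M) :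
    projSpaceMap φ M hM ≫ projSpaceToSpec n A = projSpaceToSpec n B ≫ Spec.map φ :=
  (Proj.mapAffineOpenCover (linSubst φ M) (irrelevant_le_map φ hM)).openCover.hom_ext
    _ _ fun s ↦ awayι_projSpaceMap_toSpec φ M hM s.2.2 s.1.2 ((linSubst φ M).map_mem s.2.2)

/-- The standard affine cover of `ℙ^{n-1}_A` by the `D₊(x_i)`. -/
def stdCover (n : ℕ) (A : CommRingCat.{u}) : (projSpace n A).AffineOpenCover :=
  Proj.affineOpenCoverOfIrrelevantLESpan (homogeneousSubmodule (Fin n) A) X X_mem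
    (fun _ ↦ one_pos) irrelevant_le_span

/-- `ℙ^{n-1}_B` is the base change of `ℙ^{n-1}_A` along `Spec B ⟶ Spec A`. -/
lemma isPullback_projSpaceMap (φ : A ⟶ B) :
    IsPullback (projSpaceMap φ (1 : Matrix (Fin n) (Fin n) B) isUnit_one)
      (projSpaceToSpec n B) (projSpaceToSpec n A) (Spec.map φ) := by
  refine Scheme.isPullback_of_openCover _ _ _ _ (stdCover n A).openCover fun i ↦ ?_
  have hs' : linSubst φ (1 : Matrix (Fin n) (Fin n) B) (X i) ∈ homogeneousSubmodule (Fin n) B 1 :=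
    (linSubst φ 1).map_mem (X_mem i)
  have Q : IsPullback (Proj.awayι (homogeneousSubmodule (Fin n) B) _ hs' one_pos)
      (Spec.map (CommRingCat.ofHom
        (Away.map (linSubst φ (1 : Matrix (Fin n) (Fin n) B)) (X i))))
      (projSpaceMap φ (1 : Matrix (Fin n) (Fin n) B) isUnit_one)
      ((stdCover n A).openCover.f i) := by
    refine (IsOpenImmersion.isPullback _ _ _ _
      (Proj.awayι_comp_map (linSubst φ 1) (irrelevant_le_map φ isUnit_one) one_pos
        (X i) (X_mem i)) ?_).flip
    rw [Proj.opensRange_awayι, Proj.opensRange_awayι]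
    rfl
  have P := (isPullback_SpecMap_of_isPushout _ _ _ _ (isPushout_away φ i)).flip
  refine P.of_iso Q.isoPullback (Iso.refl _) (Iso.refl _) (Iso.refl _) ?_ ?_ ?_ ?_
  · exact (Category.comp_id _).trans Q.isoPullback_hom_snd.symm
  · refine (Category.comp_id _).trans ?_
    refine Eq.trans ?_ (Category.assoc _ _ _)
    refine Eq.trans ?_ congr($(Q.isoPullback_hom_fst.symm) ≫ projSpaceToSpec n B)
    exact (awayι_projSpaceToSpec _ _).symm
  · exact (Category.comp_id _).trans
      ((awayι_projSpaceToSpec _ _).symm.trans (Category.id_comp _).symm)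
  · simp

lemma map_congr {f g : GradedRingHom
      (homogeneousSubmodule (Fin n) A) (homogeneousSubmodule (Fin n) B)}
    (h : f = g) (hf hg) : Proj.map f hf = Proj.map g hg := by
  subst h; rfl

lemma projSpaceMap_id :
    projSpaceMap (𝟙 A) (1 : Matrix (Fin n) (Fin n) A) isUnit_one = 𝟙 _ := by
  have := Proj.map_id (𝒜 := homogeneousSubmodule (Fin n) A)
  exact (map_congr linSubst_id _ _).trans this

lemma projSpaceMap_comp {D : CommRingCat.{u}} (φ : A ⟶ B) (ψ : B ⟶ D)
    (M : Matrix (Fin n) (Fin n) B) (N : Matrix (Fin n) (Fin n) D) (hM : IsUnit M) (hN : IsUnit N)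
    (hMN : IsUnit (M.map ψ.hom * N)) :
    projSpaceMap (φ ≫ ψ) (M.map ψ.hom * N) hMN = projSpaceMap ψ N hN ≫ projSpaceMap φ M hM :=
  (map_congr (linSubst_comp φ ψ M N).symm _ _).trans
    (Proj.map_comp (linSubst φ M) (linSubst ψ N) (irrelevant_le_map φ hM) (irrelevant_le_map ψ hN))

end BaseChange
/-! ### Vector bundles -/

section VectorBundle

variable {X : Scheme.{u}}

/-- Restriction of sections of an `𝒪_X`-module. -/
def res (E : X.Modules) {V U : X.Opens} (h : V ≤ U) : Γ(E, U) →+ Γ(E, V) :=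
  (E.presheaf.map (homOfLE h).op).hom

lemma res_smul (E : X.Modules) {V U : X.Opens} (h : V ≤ U) (r : Γ(X, U)) (s : Γ(E, U)) :
    res E h (r • s) = X.presheaf.map (homOfLE h).op r • res E h s :=
  Scheme.Modules.map_smul E (homOfLE h) r s

lemma res_self (E : X.Modules) {U : X.Opens} (h : U ≤ U) (s : Γ(E, U)) : res E h s = s := by
  have : E.presheaf.map (homOfLE h).op = 𝟙 _ := E.presheaf.map_id _
  rw [res, this]
  rfl

lemma res_res (E : X.Modules) {W V U : X.Opens} (h : W ≤ V) (h' : V ≤ U) (s : Γ(E, U)) :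
    res E h (res E h' s) = res E (h.trans h') s := by
  have : E.presheaf.map (homOfLE (h.trans h')).op =
    E.presheaf.map (homOfLE h').op ≫ E.presheaf.map (homOfLE h).op := E.presheaf.map_comp _ _
  rw [res, res, res, this]
  rfl

/-- Sections `e₁, …, e_m` of `E` over `U` form a *frame* if they induce an isomorphism
`𝒪_U^m ≅ E|_U`, i.e. their restrictions are a basis of `Γ(E, V)` over `Γ(X, V)` for every open
`V ⊆ U`. -/
def IsFrame (E : X.Modules) (U : X.Opens) {m : ℕ} (e : Fin m → Γ(E, U)) : Prop :=
  ∀ (V : X.Opens) (h : V ≤ U),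
    Function.Bijective fun c : Fin m → Γ(X, V) ↦ ∑ j, c j • res E h (e j)

lemma IsFrame.res {E : X.Modules} {U V : X.Opens} {m : ℕ} {e : Fin m → Γ(E, U)}
    (he : IsFrame E U e) (h : V ≤ U) : IsFrame E V fun j ↦ res E h (e j) := by
  intro W hW
  simpa only [res_res] using he W (hW.trans h)

/-- A vector bundle of rank `m` on `X`: a locally free `𝒪_X`-module of rank `m`, that is, an
`𝒪_X`-module which is isomorphic to `𝒪_U^m` over the members `U` of some open cover of `X`. -/
structure VectorBundle (X : Scheme.{u}) (m : ℕ) where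
  /-- The underlying `𝒪_X`-module, the sheaf of sections of the bundle. -/
  sheaf : X.Modules
  locallyFree : ∀ x : X, ∃ U : X.Opens, x ∈ U ∧ ∃ e : Fin m → Γ(sheaf, U), IsFrame sheaf U e

variable {m : ℕ}

/-- A frame of the vector bundle `E` over some affine open of `X`. -/
structure LocalFrame (E : VectorBundle X m) where
  U : X.Opens
  isAffineOpen : IsAffineOpen U
  e : Fin m → Γ(E.sheaf, U)
  isFrame : IsFrame E.sheaf U e

namespace LocalFrame

variable {E : VectorBundle X m}

/-- Local frames are (pre)ordered by the inclusion of their domains. -/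
instance : Preorder (LocalFrame E) := Preorder.lift LocalFrame.U

variable {i j k : LocalFrame E}

/-- For frames `f` over `V` and `e` over `U ⊇ V`, the matrix `M` over `Γ(X, V)` with
`f_b = ∑_a M_{ab} e_a|_V`. -/
def matrix (h : i ≤ j) : Matrix (Fin m) (Fin m) Γ(X, i.U) :=
  .of fun a b ↦ Function.surjInv (j.isFrame i.U h).2 (i.e b) a

lemma sum_matrix (h : i ≤ j) (b : Fin m) :
    ∑ a, matrix h a b • res E.sheaf h (j.e a) = i.e b :=
  Function.surjInv_eq (j.isFrame i.U h).2 (i.e b)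

lemma matrix_eq (h : i ≤ j) {M : Matrix (Fin m) (Fin m) Γ(X, i.U)}
    (hM : ∀ b, ∑ a, M a b • res E.sheaf h (j.e a) = i.e b) : matrix h = M := by
  ext a b
  exact congr_fun ((j.isFrame i.U h).1 (a₁ := fun a ↦ matrix h a b) (a₂ := fun a ↦ M a b)
    ((sum_matrix h b).trans (hM b).symm)) a

lemma matrix_eq_one (h : i ≤ j) (he : ∀ a, res E.sheaf h (j.e a) = i.e a) : matrix h = 1 :=
  matrix_eq h fun b ↦ by simp [he, Matrix.one_apply]

lemma matrix_comp (h : i ≤ j) (h' : j ≤ k) :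
    matrix (h.trans h') = (matrix h').map (X.presheaf.map (homOfLE h).op).hom * matrix h := by
  refine matrix_eq _ fun c ↦ ?_
  simp only [Matrix.mul_apply, Finset.sum_smul, Matrix.map_apply]
  rw [Finset.sum_comm]
  refine Eq.trans (Finset.sum_congr rfl fun b _ ↦ ?_) (sum_matrix h c)
  rw [← sum_matrix h' b, map_sum, Finset.smul_sum]
  refine Finset.sum_congr rfl fun a _ ↦ ?_
  rw [res_smul, res_res, mul_comm, mul_smul]
  rfl

/-- The restriction of a frame to a smaller affine open. -/
def restrict (j : LocalFrame E) {V : X.Opens} (hV : IsAffineOpen V) (h : V ≤ j.U) :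
    LocalFrame E where
  U := V
  isAffineOpen := hV
  e a := res E.sheaf h (j.e a)
  isFrame := j.isFrame.res h

lemma isUnit_matrix (h : i ≤ j) : IsUnit (matrix h) := by
  let j' : LocalFrame E := j.restrict i.isAffineOpen h
  have h₁ : i ≤ j' := le_refl i.U
  have h₂ : j' ≤ i := le_refl i.U
  have h₃ : j' ≤ j := h
  have e₁ := matrix_comp h₁ h₂
  have e₂ := matrix_comp h₁ h₃
  rw [matrix_eq_one _ fun a ↦ res_self _ _ _] at e₁
  rw [matrix_eq_one h₃ fun a ↦ rfl] at e₂
  have e₃ : matrix h = matrix h₁ := by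
    refine e₂.trans ?_
    rw [Matrix.map_one _ (map_zero _) (map_one _), one_mul]
  rw [e₃]
  exact IsUnit.of_mul_eq_one_right _ e₁.symm

end LocalFrame

namespace VectorBundle

variable (E : VectorBundle X m)

lemma exists_localFrame {x : X} {W : X.Opens} (hx : x ∈ W) :
    ∃ i : LocalFrame E, x ∈ i.U ∧ i.U ≤ W := by
  obtain ⟨U, hxU, e, he⟩ := E.locallyFree x
  obtain ⟨V, hV, hxV, hVU⟩ := TopologicalSpace.Opens.isBasis_iff_nbhd.mp X.isBasis_affineOpens
    (show x ∈ U ⊓ W from ⟨hxU, hx⟩)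
  exact ⟨⟨V, hV, _, he.res (hVU.trans inf_le_left)⟩, hxV, hVU.trans inf_le_right⟩

/-- The open cover of `X` by the domains of all local frames of `E`. -/
def frameCover : X.OpenCover where
  I₀ := LocalFrame E
  X i := Spec Γ(X, i.U)
  f i := i.isAffineOpen.fromSpec
  mem₀ := by
    rw [Scheme.presieve₀_mem_precoverage_iff]
    refine ⟨fun x ↦ ?_, fun i ↦ inferInstance⟩
    obtain ⟨i, hi, -⟩ := E.exists_localFrame (show x ∈ (⊤ : X.Opens) from trivial)
    exact ⟨i, by simpa using hi⟩

instance : Preorder E.frameCover.I₀ := inferInstanceAs (Preorder (LocalFrame E))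

instance {i j : E.frameCover.I₀} : Subsingleton (i ⟶ j) :=
  inferInstanceAs (Subsingleton ((show LocalFrame E from i) ⟶ j))

/-- The inclusions of domains of local frames. -/
def frameTrans {i j : LocalFrame E} (h : i ≤ j) : Spec Γ(X, i.U) ⟶ Spec Γ(X, j.U) :=
  Spec.map (X.presheaf.map (homOfLE h).op)

lemma frameTrans_fromSpec {i j : LocalFrame E} (h : i ≤ j) :
    E.frameTrans h ≫ j.isAffineOpen.fromSpec = i.isAffineOpen.fromSpec :=
  j.isAffineOpen.map_fromSpec i.isAffineOpen _

lemma frameTrans_id (i : LocalFrame E) : E.frameTrans (le_refl i) = 𝟙 _ := by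
  rw [← cancel_mono i.isAffineOpen.fromSpec, frameTrans_fromSpec, Category.id_comp]

lemma frameTrans_comp {i j k : LocalFrame E} (h : i ≤ j) (h' : j ≤ k) :
    E.frameTrans (h.trans h') = E.frameTrans h ≫ E.frameTrans h' := by
  rw [← cancel_mono k.isAffineOpen.fromSpec, Category.assoc, frameTrans_fromSpec,
    frameTrans_fromSpec, frameTrans_fromSpec]

lemma isOpenImmersion_frameTrans {i j : LocalFrame E} (h : i ≤ j) :
    IsOpenImmersion (E.frameTrans h) := by
  have : IsOpenImmersion (E.frameTrans h ≫ j.isAffineOpen.fromSpec) := by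
    rw [frameTrans_fromSpec]; infer_instance
  exact IsOpenImmersion.of_comp _ j.isAffineOpen.fromSpec

lemma frameTrans_directed {i j : LocalFrame E}
    (x : (pullback i.isAffineOpen.fromSpec j.isAffineOpen.fromSpec).carrier) :
    ∃ (k : LocalFrame E) (hi : k ≤ i) (hj : k ≤ j) (y : Spec Γ(X, k.U)),
      pullback.lift (f := i.isAffineOpen.fromSpec) (g := j.isAffineOpen.fromSpec)
        (E.frameTrans hi) (E.frameTrans hj)
        (by rw [frameTrans_fromSpec, frameTrans_fromSpec]) y = x := by
  let p := pullback.fst i.isAffineOpen.fromSpec j.isAffineOpen.fromSpec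
  let q := pullback.snd i.isAffineOpen.fromSpec j.isAffineOpen.fromSpec
  have hpq : p ≫ i.isAffineOpen.fromSpec = q ≫ j.isAffineOpen.fromSpec := pullback.condition
  have hx : (p ≫ i.isAffineOpen.fromSpec) x ∈ i.U ⊓ j.U := by
    refine ⟨?_, ?_⟩
    · exact i.isAffineOpen.opensRange_fromSpec.le ⟨p x, rfl⟩
    · rw [hpq]
      exact j.isAffineOpen.opensRange_fromSpec.le ⟨q x, rfl⟩
  obtain ⟨k, hk, hkU⟩ := E.exists_localFrame hx
  rw [← k.isAffineOpen.opensRange_fromSpec] at hk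
  obtain ⟨y, hy⟩ := hk
  refine ⟨k, hkU.trans inf_le_left, hkU.trans inf_le_right, y, ?_⟩
  apply (p ≫ i.isAffineOpen.fromSpec).isOpenEmbedding.injective
  rw [← Scheme.Hom.comp_apply, pullback.lift_fst_assoc, frameTrans_fromSpec]
  exact hy

instance : E.frameCover.LocallyDirected where
  trans hij := E.frameTrans (leOfHom hij)
  trans_id i := E.frameTrans_id i
  trans_comp hij hjk := E.frameTrans_comp (leOfHom hij) (leOfHom hjk)
  w hij := E.frameTrans_fromSpec (leOfHom hij)
  directed x := by
    obtain ⟨k, hi, hj, y, h⟩ := E.frameTrans_directed x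
    exact ⟨k, homOfLE hi, homOfLE hj, y, h⟩
  property_trans hij := E.isOpenImmersion_frameTrans (leOfHom hij)

/-- Over the domain `U` of a frame `e` the projective bundle is `ℙ^{m-1}_U`, where the point with
homogeneous coordinates `x` is the line spanned by `∑_j x_j e_j`. For a frame `f` over `V ⊆ U`,
`ℙ^{m-1}_V` is included into `ℙ^{m-1}_U` by the corresponding change of coordinates. -/
def projMap {i j : LocalFrame E} (h : i ≤ j) :
    projSpace m Γ(X, i.U) ⟶ projSpace m Γ(X, j.U) :=
  projSpaceMap (X.presheaf.map (homOfLE h).op) (LocalFrame.matrix h) (LocalFrame.isUnit_matrix h)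

lemma projMap_toSpec {i j : LocalFrame E} (h : i ≤ j) :
    E.projMap h ≫ projSpaceToSpec m Γ(X, j.U) = projSpaceToSpec m Γ(X, i.U) ≫ E.frameTrans h :=
  projSpaceMap_toSpec _ _ _

lemma projMap_id (i : LocalFrame E) : E.projMap (le_refl i) = 𝟙 _ := by
  refine Eq.trans ?_ projSpaceMap_id
  have h : X.presheaf.map (homOfLE (le_refl i.U)).op = 𝟙 _ := X.presheaf.map_id _
  have h' : LocalFrame.matrix (le_refl i) = 1 := LocalFrame.matrix_eq_one _ fun a ↦ res_self _ _ _
  unfold projMap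
  congr 1

lemma projMap_comp {i j k : LocalFrame E} (h : i ≤ j) (h' : j ≤ k) :
    E.projMap (h.trans h') = E.projMap h ≫ E.projMap h' := by
  have e := LocalFrame.matrix_comp h h'
  have e' : X.presheaf.map (homOfLE (show i.U ≤ k.U from h.trans h')).op =
      X.presheaf.map (homOfLE (show j.U ≤ k.U from h')).op ≫
        X.presheaf.map (homOfLE (show i.U ≤ j.U from h)).op := X.presheaf.map_comp _ _
  refine Eq.trans ?_ (projSpaceMap_comp (X.presheaf.map (homOfLE (show j.U ≤ k.U from h')).op)
    (X.presheaf.map (homOfLE (show i.U ≤ j.U from h)).op) _ _ (LocalFrame.isUnit_matrix h')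
    (LocalFrame.isUnit_matrix h) (e ▸ LocalFrame.isUnit_matrix _))
  unfold projMap
  congr 1

lemma isPullback_projMap {i j : LocalFrame E} (h : i ≤ j) :
    IsPullback (E.projMap h) (projSpaceToSpec m Γ(X, i.U)) (projSpaceToSpec m Γ(X, j.U))
      (E.frameTrans h) := by
  let j' : LocalFrame E := j.restrict i.isAffineOpen h
  have h₁ : i ≤ j' := le_refl i.U
  have h₂ : j' ≤ i := le_refl i.U
  have h₃ : j' ≤ j := h
  let e : projSpace m Γ(X, i.U) ≅ projSpace m Γ(X, j'.U) :=
    ⟨E.projMap h₁, E.projMap h₂, by rw [← projMap_comp]; exact E.projMap_id _,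
      by rw [← projMap_comp]; exact E.projMap_id _⟩
  have P : IsPullback (E.projMap h₃) (projSpaceToSpec m Γ(X, j'.U)) (projSpaceToSpec m Γ(X, j.U))
      (E.frameTrans h₃) := by
    have := isPullback_projSpaceMap (n := m) (X.presheaf.map (homOfLE (show j'.U ≤ j.U from h₃)).op)
    have h' : LocalFrame.matrix h₃ = 1 := LocalFrame.matrix_eq_one _ fun a ↦ rfl
    have e' : E.projMap h₃ = projSpaceMap (X.presheaf.map (homOfLE (show j'.U ≤ j.U from h₃)).op)
        (1 : Matrix (Fin m) (Fin m) _) isUnit_one := by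
      unfold projMap
      congr 1
    rw [e']
    exact this
  have : IsIso (E.projMap h₁) := ⟨e.inv, e.hom_inv_id, e.inv_hom_id⟩
  have : IsIso (E.frameTrans h₁) := by
    change IsIso (E.frameTrans (le_refl i))
    rw [frameTrans_id]
    infer_instance
  have Q := IsPullback.of_horiz_isIso (show CommSq (E.projMap h₁) _ _ _ from ⟨E.projMap_toSpec h₁⟩)
  have R := Q.paste_horiz P
  rwa [← projMap_comp, ← frameTrans_comp] at R

/-- The projective bundle is glued from the `ℙ^{m-1}_U`, for all local frames of `E`. -/
def projGluingData : E.frameCover.RelativeGluingData where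
  functor :=
    { obj i := projSpace m Γ(X, LocalFrame.U i)
      map h := E.projMap (leOfHom h)
      map_id i := E.projMap_id i
      map_comp h h' := E.projMap_comp (leOfHom h) (leOfHom h') }
  natTrans :=
    { app i := projSpaceToSpec m Γ(X, LocalFrame.U i)
      naturality _ _ h := E.projMap_toSpec (leOfHom h) }
  equifibered _ _ h := E.isPullback_projMap (leOfHom h)

/-- The projective bundle `ℙ(E)` of lines in the vector bundle `E` of rank `m`, glued from the
`ℙ^{m-1}_U` along the changes of frames. -/
def proj : Scheme.{u} := E.projGluingData.glued

/-- The structure morphism `ℙ(E) ⟶ X`. -/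
def projToBase : E.proj ⟶ X := E.projGluingData.toBase

end VectorBundle
end VectorBundle
end
end ProjectiveBundle

/-! The heuristic is point counting. If `F` were finite with `q` elements, `ℙ(V_i)` would have as
many points as `ℙ^{a_i-1} × ℙ^{m_i-1}`, and an isomorphism would give `(1 + ... + q^(a₁-1)) (1 + ...
+ q^(m₁-1)) = (1 + ... + q^(a₂-1)) (1 + ... + q^(m₂-1))`. For `q ≥ 3` such a product determines its
two factors up to order (`eq_and_eq_of_geom_sum_mul`), so `a₁ ≠ a₂` forces the swap.

Model theory reduces an arbitrary `F` to this count. Let `K` be an algebraic closure of `F`. Each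
point of a projective space has a unique normalized coordinate vector. Choosing for every base point
the first frame of a finite list, one identifies the `K`-points of `ℙ(V)` over `F` with pairs of
normalized vectors, a set that depends only on the two ranks (`exists_parametrization`). The
identification is not a morphism, but it is piecewise rational on definable pieces, so the
isomorphism becomes a bijection with definable graph (`definableSet_graph`).

That a fixed formula defines such a bijection for some choice of parameters is a first-order
sentence. It therefore holds over an algebraic closure of some `𝔽_p`, by completeness of `ACF_p` and
the Lefschetz principle (`exists_prime_realize`). There the parameters lie in a finite field, a
power of Frobenius fixes them, and the bijection restricts to its fixed points. Counting these gives
the identity above (`eq_and_eq_of_definable_isBijGraph`). Neither the bundles nor the isomorphism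
have to be reduced modulo `p`; only the formula is transferred. -/

/-! ### Normalized vectors and graphs of bijections -/

/-- A vector is normalized if its first nonzero entry is `1`. -/
def IsNormalized {K : Type*} [Zero K] [One K] {n : ℕ} (x : Fin n → K) : Prop :=
  ∃ i, x i = 1 ∧ ∀ j < i, x j = 0

/-- `G` restricts to the graph of a bijection between `S` and `T`. -/
def IsBijGraph {A B : Type*} (S : Set A) (T : Set B) (G : A → B → Prop) : Prop :=
  (∀ v ∈ S, ∃! w, w ∈ T ∧ G v w) ∧ ∀ w ∈ T, ∃! v, v ∈ S ∧ G v w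

lemma IsBijGraph.ncard_eq {A B : Type*} {S : Set A} {T : Set B} {G : A → B → Prop}
    (h : IsBijGraph S T G) : S.ncard = T.ncard := by
  choose f hf hf' using h.1
  refine Set.ncard_congr f (fun v hv ↦ (hf v hv).1) (fun v w hv hw e ↦ ?_) fun w hw ↦ ?_
  · exact (h.2 _ (hf v hv).1).unique ⟨hv, (hf v hv).2⟩ ⟨hw, e ▸ (hf w hw).2⟩
  · obtain ⟨v, ⟨hv, hvw⟩, -⟩ := h.2 w hw
    exact ⟨v, hv, (hf' v hv w ⟨hw, hvw⟩).symm⟩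

/-- If `v` is fixed and related to `w`, then `v = f v` is also related to `g w`, so `g w = w` by
uniqueness; the other direction is symmetric. It will be applied with a power of Frobenius on both
sides. -/
lemma IsBijGraph.inter_fixed {A B : Type*} {S : Set A} {T : Set B} {G : A → B → Prop}
    (h : IsBijGraph S T G) (f : A → A) (g : B → B) (hf : ∀ v ∈ S, f v ∈ S)
    (hg : ∀ w ∈ T, g w ∈ T) (hG : ∀ v w, G v w → G (f v) (g w)) :
    IsBijGraph (S ∩ {v | f v = v}) (T ∩ {w | g w = w}) G := by
  refine ⟨fun v hv ↦ ?_, fun w hw ↦ ?_⟩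
  · obtain ⟨w, ⟨hw, hvw⟩, hu⟩ := h.1 v hv.1
    refine ⟨w, ⟨⟨hw, hu _ ⟨hg w hw, ?_⟩⟩, hvw⟩, fun w' hw' ↦ hu w' ⟨hw'.1.1, hw'.2⟩⟩
    have := hG v w hvw
    rwa [show f v = v from hv.2] at this
  · obtain ⟨v, ⟨hv, hvw⟩, hu⟩ := h.2 w hw.1
    refine ⟨v, ⟨⟨hv, hu _ ⟨hf v hv, ?_⟩⟩, hvw⟩, fun v' hv' ↦ hu v' ⟨hv'.1.1, hv'.2⟩⟩
    have := hG v w hvw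
    rwa [show g w = w from hw.2] at this

/-! ### Counting points of products of projective spaces -/

section Counting

open Finset in
-- Induction on the cell decomposition of projective space: the first entry is either `1`, with an
-- arbitrary tail, or `0`, with a normalized tail. The set `E` is only a finite set containing `0`
-- and `1`; later it is the fixed field of a Frobenius power.
lemma ncard_isNormalized {k : Type*} [Field k] {E : Set k} (hE : E.Finite) (h0 : 0 ∈ E)
    (h1 : 1 ∈ E) (n : ℕ) :
    {x : Fin n → k | IsNormalized x ∧ ∀ i, x i ∈ E}.ncard = ∑ i ∈ range n, E.ncard ^ i := by
  have hpi (n : ℕ) : {x : Fin n → k | ∀ i, x i ∈ E}.ncard = E.ncard ^ n := by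
    rw [← Nat.card_coe_set_eq, ← Nat.card_coe_set_eq]
    refine (Nat.card_congr (Equiv.subtypePiEquivPi (p := fun _ t ↦ t ∈ E))).trans ?_
    rw [Nat.card_fun, Nat.card_fin]
  have hfin (n : ℕ) : {x : Fin n → k | ∀ i, x i ∈ E}.Finite :=
    Set.Finite.pi' (fun _ : Fin n ↦ hE)
  induction n with
  | zero =>
    rw [range_zero, sum_empty, Set.ncard_eq_zero ((hfin 0).subset fun x hx ↦ hx.2)]
    simp [IsNormalized]
  | succ n ih =>
    have h : {x : Fin (n + 1) → k | IsNormalized x ∧ ∀ i, x i ∈ E} =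
        Fin.cons (α := fun _ ↦ k) 1 '' {x | ∀ i, x i ∈ E} ∪
          Fin.cons (α := fun _ ↦ k) 0 '' {x | IsNormalized x ∧ ∀ i, x i ∈ E} := by
      ext x
      constructor
      · rintro ⟨⟨i, hi, hj⟩, hx⟩
        refine Fin.cases (fun hi hj ↦ Or.inl ⟨Fin.tail x, fun i ↦ hx _, ?_⟩)
          (fun i hi hj ↦ Or.inr ⟨Fin.tail x, ⟨⟨i, hi, fun j h ↦ hj _ ?_⟩, fun i ↦ hx _⟩, ?_⟩)
          i hi hj
        · rw [← hi, Fin.cons_self_tail]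
        · simpa using h
        · rw [← hj 0 (by simp), Fin.cons_self_tail]
      · rintro (⟨y, hy, rfl⟩ | ⟨y, ⟨⟨i, hi, hj⟩, hy⟩, rfl⟩)
        · exact ⟨⟨0, by simp, by simp⟩, Fin.cases (by simpa) (by simpa using hy)⟩
        · refine ⟨⟨i.succ, by simpa, Fin.cases (by simp) (by simpa using hj)⟩,
            Fin.cases (by simpa) (by simpa using hy)⟩
    rw [h, Set.ncard_union_eq _ ((hfin n).image _) (((hfin n).subset fun x hx ↦ hx.2).image _),
      Set.ncard_image_of_injective _ (Fin.cons_right_injective _),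
      Set.ncard_image_of_injective _ (Fin.cons_right_injective _), hpi, ih, sum_range_succ,
      add_comm]
    rw [Set.disjoint_left]
    rintro _ ⟨y, -, rfl⟩ ⟨z, -, e⟩
    simpa using congr_fun e 0

/-- After expanding and cancelling the `1`s, `q ^ a` is the lowest power of `q` that occurs.
Dividing by it and reducing modulo `q` leaves only its coefficient, which is `-2` if `m = a` and
`-1` otherwise; neither is divisible by `q ≥ 3`. -/
lemma eq_of_pow_sub_one_mul {q a m b l : ℕ} (hq : 3 ≤ q) (ha : 1 ≤ a) (hab : a < b) (ham : a ≤ m)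
    (hbl : b ≤ l) :
    ((q : ℤ) ^ a - 1) * ((q : ℤ) ^ m - 1) ≠ ((q : ℤ) ^ b - 1) * ((q : ℤ) ^ l - 1) := by
  intro h
  have hq0 : (q : ℤ) ^ a ≠ 0 := by positivity
  obtain ⟨b, rfl⟩ := Nat.exists_eq_add_of_lt hab
  obtain ⟨l, rfl⟩ := Nat.exists_eq_add_of_le hbl
  obtain ⟨m, rfl⟩ := Nat.exists_eq_add_of_le ham
  rcases m with _ | m
  · obtain ⟨a, rfl⟩ := Nat.exists_eq_add_of_le ha
    have : (q : ℤ) ∣ 2 := by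
      refine ⟨(q : ℤ) ^ a + q ^ b + q ^ (b + l) - q ^ (1 + a + b + b + l + 1), ?_⟩
      apply mul_left_cancel₀ hq0
      ring_nf at h ⊢
      linarith
    have := Int.le_of_dvd (by norm_num) this
    omega
  · have : (q : ℤ) ∣ 1 := by
      refine ⟨(q : ℤ) ^ (a + m) - q ^ m + (q : ℤ) ^ b + q ^ (b + l) -
        q ^ (a + b + b + l + 1), ?_⟩
      apply mul_left_cancel₀ hq0
      ring_nf at h ⊢
      linarith
    have := Int.le_of_dvd (by norm_num) this
    omega

open Finset in
/-- The number of points of a product of two projective spaces over a finite field with at least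
three elements determines the factors. -/
lemma eq_and_eq_of_geom_sum_mul {q a m b l : ℕ} (hq : 3 ≤ q) (ha : 1 ≤ a) (hm : 1 ≤ m)
    (hb : 1 ≤ b) (hl : 1 ≤ l)
    (h : (∑ i ∈ range a, q ^ i) * ∑ i ∈ range m, q ^ i =
      (∑ i ∈ range b, q ^ i) * ∑ i ∈ range l, q ^ i) (hab : a ≠ b) : m = b ∧ l = a := by
  have h' : ((q : ℤ) ^ a - 1) * ((q : ℤ) ^ m - 1) = ((q : ℤ) ^ b - 1) * ((q : ℤ) ^ l - 1) := by
    simp only [← geom_sum_mul]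
    have := congr_arg (Nat.cast : ℕ → ℤ) h
    push_cast at this
    linear_combination ((q : ℤ) - 1) ^ 2 * this
  have hcancel {x y z : ℕ} (hx : 1 ≤ x)
      (e : ((q : ℤ) ^ x - 1) * ((q : ℤ) ^ y - 1) = ((q : ℤ) ^ x - 1) * ((q : ℤ) ^ z - 1)) :
      y = z := by
    have : (q : ℤ) ^ x - 1 ≠ 0 := by
      have : (1 : ℤ) < (q : ℤ) ^ x := one_lt_pow₀ (by exact_mod_cast (by omega : 1 < q)) (by omega)
      omega
    have := mul_left_cancel₀ this e
    exact Nat.pow_right_injective (by omega : 2 ≤ q) (by simp only []; zify; linarith)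
  -- The smaller exponent on each side is determined by the product; with `hcancel` the unordered
  -- pair of exponents is determined. The four cases below are the possible positions of the two
  -- minima.
  have hmin {a m b l : ℕ} (ha : 1 ≤ a) (hb : 1 ≤ b) (ham : a ≤ m) (hbl : b ≤ l)
      (h : ((q : ℤ) ^ a - 1) * ((q : ℤ) ^ m - 1) = ((q : ℤ) ^ b - 1) * ((q : ℤ) ^ l - 1)) :
      a = b := by
    rcases lt_trichotomy a b with hab | hab | hab
    · exact absurd h (eq_of_pow_sub_one_mul hq ha hab ham hbl)
    · exact hab
    · exact absurd h.symm (eq_of_pow_sub_one_mul hq hb hab hbl ham)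
  rcases le_total a m with h₁ | h₁ <;> rcases le_total b l with h₂ | h₂
  · exact absurd (hmin ha hb h₁ h₂ h') hab
  · have e := hmin ha hl h₁ h₂ (h'.trans (mul_comm _ _))
    subst e
    exact ⟨hcancel ha (h'.trans (mul_comm _ _)), rfl⟩
  · have e := hmin hm hb h₁ h₂ ((mul_comm _ _).trans h')
    subst e
    exact ⟨rfl, (hcancel hm ((mul_comm _ _).trans h')).symm⟩
  · have e := hmin hm hl h₁ h₂ ((mul_comm _ _).trans (h'.trans (mul_comm _ _)))
    subst e
    exact absurd (hcancel hm ((mul_comm _ _).trans (h'.trans (mul_comm _ _)))) hab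

end Counting

/-! ### Transfer to the algebraic closure of a finite field -/

section Transfer

open FirstOrder Language Field Ring

/-- The sentence stating that for some choice of parameters, the relation defined by `φ` is the
graph of a bijection between the sets defined by `ζ` and `ξ`. -/
noncomputable def bijGraphSentence {γ α β : Type*} [Finite γ] [Finite α] [Finite β]
    (φ : Language.ring.Formula (γ ⊕ (α ⊕ β))) (ζ : Language.ring.Formula α)
    (ξ : Language.ring.Formula β) : Language.ring.Sentence :=
  Formula.iExs γ <| Formula.relabel (Sum.inr : γ → Empty ⊕ γ) <|
    (Formula.iAlls α <| (ζ.relabel (Sum.inr : α → γ ⊕ α)).imp <|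
      Formula.iExsUnique β <| ξ.relabel (Sum.inr : β → (γ ⊕ α) ⊕ β) ⊓
        φ.relabel (Equiv.sumAssoc γ α β).symm) ⊓
    (Formula.iAlls β <| (ξ.relabel (Sum.inr : β → γ ⊕ β)).imp <|
      -- In this half the `β`-variables are quantified first, so the relabelling of `φ` has to
      -- interchange the two blocks.
      Formula.iExsUnique α <| ζ.relabel (Sum.inr : α → (γ ⊕ β) ⊕ α) ⊓
        φ.relabel (Sum.elim (Sum.inl ∘ Sum.inl) (Sum.elim Sum.inr (Sum.inl ∘ Sum.inr))))

lemma realize_bijGraphSentence {γ α β : Type*} [Finite γ] [Finite α] [Finite β]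
    {φ : Language.ring.Formula (γ ⊕ (α ⊕ β))} {ζ : Language.ring.Formula α}
    {ξ : Language.ring.Formula β} {M : Type*} [Language.ring.Structure M] :
    M ⊨ bijGraphSentence φ ζ ξ ↔ ∃ c : γ → M, IsBijGraph {v : α → M | ζ.Realize v}
      {w : β → M | ξ.Realize w} fun v w ↦ φ.Realize (Sum.elim c (Sum.elim v w)) := by
  have h₁ (c : γ → M) (v : α → M) (w : β → M) :
      Sum.elim (Sum.elim c v) w ∘ (Equiv.sumAssoc γ α β).symm = Sum.elim c (Sum.elim v w) := by
    ext (_ | _ | _) <;> rfl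
  have h₂ (c : γ → M) (v : α → M) (w : β → M) :
      Sum.elim (Sum.elim c w) v ∘ Sum.elim (Sum.inl ∘ Sum.inl)
        (Sum.elim Sum.inr (Sum.inl ∘ Sum.inr)) = Sum.elim c (Sum.elim v w) := by
    ext (_ | _ | _) <;> rfl
  simp only [bijGraphSentence, Sentence.Realize, Formula.realize_iExs, Formula.realize_relabel,
    Formula.realize_inf, Formula.realize_iAlls, Formula.realize_imp, Formula.realize_iExsUnique,
    Sum.elim_comp_inr, h₁, h₂]
  rfl

/-- In positive characteristic this is completeness of `ACF p`. In characteristic zero, a sentence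
true in `ACF 0` holds in `ACF q` for infinitely many primes `q`. -/
lemma exists_prime_realize {K : Type*} [Field K] [IsAlgClosed K] [CompatibleRing K]
    {φ : Language.ring.Sentence} (h : K ⊨ φ) : ∃ p : ℕ, p.Prime ∧ Theory.ACF p ⊨ᵇ φ := by
  obtain ⟨p, hp⟩ := CharP.exists K
  rcases CharP.char_is_prime_or_zero K p with hp' | rfl
  · exact ⟨p, hp', ((ACF_isComplete (Or.inl hp')).realize_sentence_iff φ K).mp h⟩
  · have := ((ACF_isComplete (Or.inr rfl)).realize_sentence_iff φ K).mp h
    obtain ⟨q, hq⟩ := (ACF_zero_realize_iff_infinite_ACF_prime_realize.mp this).nonempty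
    exact ⟨q, q.2, hq⟩

/-- Finitely many elements algebraic over `𝔽_p` generate a finite field. -/
lemma exists_frobenius_fixed (p : ℕ) [Fact p.Prime] {γ : Type*} [Finite γ]
    (c : γ → AlgebraicClosure (ZMod p)) : ∃ n : ℕ, 2 ≤ n ∧ ∀ i, c i ^ p ^ n = c i := by
  let L := IntermediateField.adjoin (ZMod p) (Set.range c)
  have : FiniteDimensional (ZMod p) L :=
    IntermediateField.finiteDimensional_adjoin fun x _ ↦ (Algebra.IsAlgebraic.isAlgebraic x).isIntegral
  have : Finite L := Module.finite_of_finite (ZMod p)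
  have : Fintype L := Fintype.ofFinite L
  obtain ⟨n, hn, hn'⟩ := FiniteField.card L p
  -- Doubling the degree `n ≥ 1` of that field keeps its elements fixed and makes the exponent at
  -- least `2`, so that `q = p ^ (n * 2) ≥ 4`.
  refine ⟨n * 2, by have := n.pos; omega, fun i ↦ ?_⟩
  have := FiniteField.pow_card_pow 2
    (⟨c i, IntermediateField.subset_adjoin _ _ ⟨i, rfl⟩⟩ : L)
  rw [hn', ← pow_mul] at this
  exact congr_arg Subtype.val this

lemma ncard_frobenius_fixed (p n : ℕ) [Fact p.Prime] (hn : n ≠ 0) :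
    {x : AlgebraicClosure (ZMod p) | x ^ p ^ n = x}.ncard = p ^ n := by
  have h1 : 1 < p ^ n := Nat.one_lt_pow hn (Fact.out : p.Prime).one_lt
  have h := Polynomial.card_rootSet_eq_natDegree (K := AlgebraicClosure (ZMod p))
    (galois_poly_separable (K := ZMod p) p (p ^ n) (dvd_pow_self p hn))
    (IsAlgClosed.splits _)
  rw [FiniteField.X_pow_card_sub_X_natDegree_eq _ h1, ← Nat.card_eq_fintype_card,
    Nat.card_coe_set_eq] at h
  refine Eq.trans (congr_arg Set.ncard ?_) h
  ext x
  rw [Polynomial.mem_rootSet_of_ne (FiniteField.X_pow_card_sub_X_ne_zero _ h1)]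
  simp [sub_eq_zero]

/-- The formula defining normalized vectors. -/
noncomputable def normalizedFormula {α : Type*} {n : ℕ} (f : Fin n → α) :
    Language.ring.Formula α :=
  BoundedFormula.iSup fun i : Fin n ↦ Term.equal (.var (f i)) 1 ⊓
    BoundedFormula.iInf fun j : {j // j < i} ↦ Term.equal (.var (f j)) 0

lemma realize_normalizedFormula {α : Type*} {n : ℕ} {f : Fin n → α} {K : Type*} [Field K]
    [CompatibleRing K] {v : α → K} :
    (normalizedFormula f).Realize v ↔ IsNormalized (v ∘ f) := by
  simp [normalizedFormula, IsNormalized, Formula.Realize, Term.equal]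

/-- The pairs of normalized vectors of length `a` and `m`, that is, the points of the product
of two projective spaces. -/
def normalizedPairs (a m : ℕ) (K : Type*) [Field K] : Set (Fin a ⊕ Fin m → K) :=
  {v | IsNormalized (v ∘ Sum.inl) ∧ IsNormalized (v ∘ Sum.inr)}

lemma ncard_normalizedPairs {k : Type*} [Field k] {E : Set k} (hE : E.Finite) (h0 : 0 ∈ E)
    (h1 : 1 ∈ E) (a m : ℕ) :
    (normalizedPairs a m k ∩ {v | ∀ i, v i ∈ E}).ncard =
      (∑ i ∈ Finset.range a, E.ncard ^ i) * ∑ i ∈ Finset.range m, E.ncard ^ i := by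
  rw [← ncard_isNormalized hE h0 h1, ← ncard_isNormalized hE h0 h1, ← Set.ncard_prod,
    ← Set.ncard_image_of_injective _ (Equiv.sumArrowEquivProdArrow _ _ _).injective]
  congr 1
  ext ⟨x, y⟩
  rw [Equiv.image_eq_preimage_symm]
  simp [normalizedPairs, Equiv.sumArrowEquivProdArrow, and_and_and_comm]

/-- If there is a definable bijection between the products of projective spaces
`ℙ^{a-1} × ℙ^{m-1}` and `ℙ^{b-1} × ℙ^{l-1}` over an algebraically closed field, then the two
products have the same factors. -/
theorem eq_and_eq_of_definable_isBijGraph {K : Type*} [Field K] [IsAlgClosed K] [CompatibleRing K]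
    {a m b l : ℕ} (ha : 1 ≤ a) (hm : 1 ≤ m) (hb : 1 ≤ b) (hl : 1 ≤ l) (hab : a ≠ b)
    {G : Set ((Fin a ⊕ Fin m) ⊕ (Fin b ⊕ Fin l) → K)}
    (hG : (Set.univ : Set K).Definable Language.ring G)
    (h : IsBijGraph (normalizedPairs a m K) (normalizedPairs b l K)
      fun v w ↦ Sum.elim v w ∈ G) : m = b ∧ l = a := by
  -- A definition uses only finitely many parameters, which can then be quantified away in `θ`.
  obtain ⟨A, -, hA⟩ := Set.definable_iff_finitely_definable.mp hG
  obtain ⟨φ, rfl⟩ := Set.definable_iff_exists_formula_sum.mp hA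
  let θ := bijGraphSentence φ (normalizedFormula Sum.inl ⊓ normalizedFormula Sum.inr)
    (normalizedFormula Sum.inl ⊓ normalizedFormula Sum.inr)
  have hθ : K ⊨ θ := by
    refine realize_bijGraphSentence.mpr ⟨(↑), ?_⟩
    simp only [Formula.realize_inf, realize_normalizedFormula]
    exact h
  obtain ⟨p, hp, hpθ⟩ := exists_prime_realize hθ
  have : Fact p.Prime := ⟨hp⟩
  let k := AlgebraicClosure (ZMod p)
  let _ : CompatibleRing k := compatibleRingOfRing k
  have hkθ : k ⊨ θ := ((ACF_isComplete (Or.inl hp)).realize_sentence_iff θ k).mpr hpθ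
  obtain ⟨c, hc⟩ := realize_bijGraphSentence.mp hkθ
  simp only [Formula.realize_inf, realize_normalizedFormula] at hc
  obtain ⟨n, hn, hcn⟩ := exists_frobenius_fixed p c
  let σ : k ≃+* k := iterateFrobeniusEquiv k p n
  have hσ (x : k) : σ x = x ^ p ^ n := iterateFrobeniusEquiv_def k p n x
  have hσn {r : ℕ} {x : Fin r → k} (hx : IsNormalized x) : IsNormalized (σ ∘ x) := by
    obtain ⟨i, hi, hj⟩ := hx
    exact ⟨i, by simp [hi], fun j h ↦ by simp [hj j h]⟩
  -- The field automorphism `σ` preserves the truth of `φ` and fixes the parameters `c`, so it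
  -- preserves the graph.
  have key := (hc.inter_fixed (fun v ↦ σ ∘ v) (fun w ↦ σ ∘ w)
    (fun v hv ↦ ⟨hσn hv.1, hσn hv.2⟩) (fun v hv ↦ ⟨hσn hv.1, hσn hv.2⟩) (fun v w hvw ↦ by
      have := (StrongHomClass.realize_formula (languageEquivEquivRingEquiv.symm σ) φ).mpr hvw
      convert this using 1
      ext (i | i | i)
      · exact (hcn i).symm.trans (hσ _).symm
      · rfl
      · rfl)).ncard_eq
  have hE := ncard_frobenius_fixed p n (by omega)
  -- A vector is fixed by `σ` exactly when its entries lie in the field of `p ^ n` elements.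
  have hfix (a m : ℕ) : (normalizedPairs a m k ∩ {v | σ ∘ v = v}).ncard =
      (∑ i ∈ Finset.range a, (p ^ n) ^ i) * ∑ i ∈ Finset.range m, (p ^ n) ^ i := by
    have := ncard_normalizedPairs (Set.finite_of_ncard_pos (hE.symm ▸ pow_pos hp.pos n :
      0 < {x : k | x ^ p ^ n = x}.ncard)) (by simp [hp.ne_zero]) (by simp) a m
    rw [hE] at this
    rw [← this]
    congr 2
    ext v
    simp only [funext_iff, Set.mem_ofPred_eq, Function.comp_apply, hσ]
    rfl
  refine eq_and_eq_of_geom_sum_mul (q := p ^ n) ?_ ha hm hb hl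
    ((hfix a m).symm.trans (key.trans (hfix b l))) hab
  calc 3 ≤ 2 ^ 2 := by norm_num
    _ ≤ p ^ n := (Nat.pow_le_pow_left hp.two_le 2).trans (Nat.pow_le_pow_right hp.pos hn)

end Transfer

/-! ### Piecewise rational functions on definable sets -/

section PiecewiseRational

open FirstOrder MvPolynomial

variable {I J K : Type*} [Field K] [Ring.CompatibleRing K] {S T : Set (I → K)}

/-- Sets which are definable with parameters in the language of rings. -/
abbrev DefinableSet (S : Set (I → K)) : Prop := (Set.univ : Set K).Definable Language.ring S

lemma DefinableSet.eval_eq_zero (p : MvPolynomial I K) : DefinableSet {v | eval v p = 0} := by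
  have h := Ring.mvPolynomial_zeroLocus_definable {p}
  rw [zeroLocus_span] at h
  convert! h.mono (Set.subset_univ _) using 1
  ext v
  simp [aeval_eq_eval]

/-- A function on a subset of `K ^ I` which is a quotient of polynomials on each piece of a
finite partition into definable sets. -/
def PiecewiseRational (f : S → K) : Prop :=
  ∃ (n : ℕ) (P : Fin n → Set (I → K)), (∀ k, DefinableSet (P k)) ∧ S ⊆ ⋃ k, P k ∧
    ∀ k, ∃ p q : MvPolynomial I K, ∀ v : S, v.1 ∈ P k →
      eval v.1 q ≠ 0 ∧ f v * eval v.1 q = eval v.1 p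

namespace PiecewiseRational

variable {f g : S → K}

lemma of_pieces {ι : Type*} [Finite ι] {P : ι → Set (I → K)} (hP : ∀ k, DefinableSet (P k))
    (hS : S ⊆ ⋃ k, P k) (h : ∀ k, ∃ p q : MvPolynomial I K, ∀ v : S, v.1 ∈ P k →
      eval v.1 q ≠ 0 ∧ f v * eval v.1 q = eval v.1 p) : PiecewiseRational f := by
  obtain ⟨n, ⟨e⟩⟩ := Finite.exists_equiv_fin ι
  refine ⟨n, P ∘ e.symm, fun k ↦ hP _, hS.trans_eq ?_, fun k ↦ h _⟩
  exact (e.symm.surjective.iUnion_comp P).symm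

lemma of_eval (p : MvPolynomial I K) : PiecewiseRational fun v : S ↦ eval v.1 p :=
  of_pieces (ι := Unit) (P := fun _ ↦ Set.univ) (fun _ ↦ Set.definable_univ)
    (fun _ _ ↦ Set.mem_iUnion.mpr ⟨(), trivial⟩)
    fun _ ↦ ⟨p, 1, fun v _ ↦ by simp⟩

lemma const (c : K) : PiecewiseRational fun _ : S ↦ c := by
  simpa using of_eval (S := S) (C c)

lemma coord (i : I) : PiecewiseRational fun v : S ↦ v.1 i := by
  simpa using of_eval (S := S) (X i)

/-- Pass to the common refinement of the two partitions; it then remains to combine one fraction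
with another. -/
lemma binary (hf : PiecewiseRational f) (hg : PiecewiseRational g) {h : S → K}
    (H : ∀ p q r s : MvPolynomial I K, ∃ a b : MvPolynomial I K, ∀ v : S, eval v.1 q ≠ 0 →
      f v * eval v.1 q = eval v.1 p → eval v.1 s ≠ 0 → g v * eval v.1 s = eval v.1 r →
      eval v.1 b ≠ 0 ∧ h v * eval v.1 b = eval v.1 a) : PiecewiseRational h := by
  obtain ⟨n, P, hP, hS, hf⟩ := hf
  obtain ⟨m, Q, hQ, hS', hg⟩ := hg
  refine of_pieces (ι := Fin n × Fin m) (P := fun k ↦ P k.1 ∩ Q k.2)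
    (fun k ↦ (hP _).inter (hQ _)) (fun v hv ↦ ?_) fun k ↦ ?_
  · obtain ⟨i, hi⟩ := Set.mem_iUnion.mp (hS hv)
    obtain ⟨j, hj⟩ := Set.mem_iUnion.mp (hS' hv)
    exact Set.mem_iUnion.mpr ⟨(i, j), hi, hj⟩
  · obtain ⟨p, q, hpq⟩ := hf k.1
    obtain ⟨r, s, hrs⟩ := hg k.2
    obtain ⟨a, b, hab⟩ := H p q r s
    exact ⟨a, b, fun v hv ↦ hab v (hpq v hv.1).1 (hpq v hv.1).2 (hrs v hv.2).1 (hrs v hv.2).2⟩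

lemma add (hf : PiecewiseRational f) (hg : PiecewiseRational g) :
    PiecewiseRational fun v ↦ f v + g v := by
  refine hf.binary hg fun p q r s ↦ ⟨p * s + r * q, q * s, fun v h₁ h₂ h₃ h₄ ↦ ?_⟩
  simp only [map_mul, map_add, ← h₂, ← h₄]
  exact ⟨mul_ne_zero h₁ h₃, by ring⟩

lemma mul (hf : PiecewiseRational f) (hg : PiecewiseRational g) :
    PiecewiseRational fun v ↦ f v * g v := by
  refine hf.binary hg fun p q r s ↦ ⟨p * r, q * s, fun v h₁ h₂ h₃ h₄ ↦ ?_⟩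
  simp only [map_mul, ← h₂, ← h₄]
  exact ⟨mul_ne_zero h₁ h₃, by ring⟩

lemma sub (hf : PiecewiseRational f) (hg : PiecewiseRational g) :
    PiecewiseRational fun v ↦ f v - g v := by
  simpa [sub_eq_add_neg] using hf.add ((const (-1)).mul hg)

/-- On a piece where `f = p / q`, the zeros of `f` are those of `p`, since `q` does not vanish
there. -/
lemma definableSet_eq_zero (hf : PiecewiseRational f) (hS : DefinableSet S) :
    DefinableSet {v | ∃ h : v ∈ S, f ⟨v, h⟩ = 0} := by
  obtain ⟨n, P, hP, hSP, hf⟩ := hf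
  choose p q hpq using hf
  convert hS.inter (Set.definable_iUnion_of_finite fun k ↦
    (hP k).inter (DefinableSet.eval_eq_zero (p k))) using 1
  ext v
  simp only [Set.mem_ofPred_eq, Set.mem_inter_iff, Set.mem_iUnion]
  refine ⟨fun ⟨h, h0⟩ ↦ ⟨h, ?_⟩, fun ⟨h, k, hk, h0⟩ ↦ ⟨h, ?_⟩⟩
  · obtain ⟨k, hk⟩ := Set.mem_iUnion.mp (hSP h)
    refine ⟨k, hk, ?_⟩
    simpa [h0] using (hpq k ⟨v, h⟩ hk).2.symm
  · obtain ⟨h1, h2⟩ := hpq k ⟨v, h⟩ hk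
    rw [h0] at h2
    exact (mul_eq_zero.mp h2).resolve_right h1

lemma definableSet_ne_zero (hf : PiecewiseRational f) (hS : DefinableSet S) :
    DefinableSet {v | ∃ h : v ∈ S, f ⟨v, h⟩ ≠ 0} := by
  convert hS.sdiff (hf.definableSet_eq_zero hS) using 1
  ext v
  by_cases h : v ∈ S <;> simp [h]

lemma comp_inclusion (hf : PiecewiseRational f) (h : T ⊆ S) :
    PiecewiseRational (f ∘ Set.inclusion h) := by
  obtain ⟨n, P, hP, hSP, hf⟩ := hf
  refine ⟨n, P, hP, h.trans hSP, fun k ↦ ?_⟩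
  obtain ⟨p, q, hpq⟩ := hf k
  exact ⟨p, q, fun v hv ↦ hpq (Set.inclusion h v) hv⟩

lemma comp_reindex (hf : PiecewiseRational f) (e : I → J) {T : Set (J → K)}
    (h : ∀ v ∈ T, v ∘ e ∈ S) : PiecewiseRational fun v : T ↦ f ⟨v.1 ∘ e, h v.1 v.2⟩ := by
  obtain ⟨n, P, hP, hSP, hf⟩ := hf
  refine ⟨n, fun k ↦ {v | v ∘ e ∈ P k}, fun k ↦ (hP k).preimage_comp e, fun v hv ↦ ?_, fun k ↦ ?_⟩
  · simpa using hSP (h v hv)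
  · obtain ⟨p, q, hpq⟩ := hf k
    exact ⟨rename e p, rename e q, fun v hv ↦ by
      simpa only [eval_rename] using hpq ⟨v.1 ∘ e, h v.1 v.2⟩ hv⟩

/-- A function that is a quotient of piecewise rational functions on each piece of a finite
definable cover is piecewise rational. -/
lemma of_cover {ι : Type*} [Finite ι] {P : ι → Set (I → K)} (hP : ∀ k, DefinableSet (P k))
    (hS : S ⊆ ⋃ k, P k) (h : ∀ k, ∃ a b : S → K, PiecewiseRational a ∧ PiecewiseRational b ∧
      ∀ v : S, v.1 ∈ P k → b v ≠ 0 ∧ f v * b v = a v) : PiecewiseRational f := by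
  choose a b ha hb hab using h
  choose n P₁ hP₁ hS₁ H₁ using ha
  choose m P₂ hP₂ hS₂ H₂ using hb
  choose p q hpq using H₁
  choose r s hrs using H₂
  refine of_pieces (ι := Σ k, Fin (n k) × Fin (m k))
    (P := fun k ↦ P k.1 ∩ (P₁ k.1 k.2.1 ∩ P₂ k.1 k.2.2))
    (fun k ↦ (hP _).inter ((hP₁ _ _).inter (hP₂ _ _))) (fun v hv ↦ ?_) fun ⟨k, i, j⟩ ↦ ?_
  · obtain ⟨k, hk⟩ := Set.mem_iUnion.mp (hS hv)
    obtain ⟨i, hi⟩ := Set.mem_iUnion.mp (hS₁ k hv)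
    obtain ⟨j, hj⟩ := Set.mem_iUnion.mp (hS₂ k hv)
    exact Set.mem_iUnion.mpr ⟨⟨k, i, j⟩, hk, hi, hj⟩
  · refine ⟨p k i * s k j, q k i * r k j, fun v ⟨h₀, h₁, h₂⟩ ↦ ?_⟩
    obtain ⟨e₁, e₂⟩ := hab k v h₀
    obtain ⟨e₃, e₄⟩ := hpq k i v h₁
    obtain ⟨e₅, e₆⟩ := hrs k j v h₂
    simp only [map_mul, ← e₄, ← e₆, ← e₂]
    exact ⟨mul_ne_zero e₃ (mul_ne_zero e₁ e₅), by ring⟩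

lemma pow (hf : PiecewiseRational f) (n : ℕ) : PiecewiseRational fun v ↦ f v ^ n := by
  induction n with
  | zero => simpa using const 1
  | succ n ih => simpa only [pow_succ] using ih.mul hf

/-- Both the coefficients and the coordinates may vary with the parameter. This is the case of
functions on `ℙ^{m-1}_U`, where `ψ v` is evaluation at a moving base point. -/
lemma eval₂Hom {A σ : Type*} [CommRing A] {ψ : S → A →+* K} (hψ : ∀ a, PiecewiseRational (ψ · a))
    {x : S → σ → K} (hx : ∀ i, PiecewiseRational (x · i)) (p : MvPolynomial σ A) :
    PiecewiseRational fun v ↦ MvPolynomial.eval₂Hom (ψ v) (x v) p := by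
  induction p using MvPolynomial.induction_on with
  | C a => simpa using hψ a
  | add p q hp hq => simpa only [map_add] using hp.add hq
  | mul_X p i hp => simpa only [map_mul, eval₂Hom_X'] using hp.mul (hx i)

end PiecewiseRational

end PiecewiseRational

/-! ### Points of schemes in affine charts -/

section Charts

open FirstOrder CategoryTheory AlgebraicGeometry


variable {I : Type*} {K : Type u} [Field K] {S : Set (I → K)}
  {X : Scheme.{u}} {A B : CommRingCat.{u}}

/-- The opens of the spectrum of a Noetherian ring are finite unions of principal opens. -/
lemma exists_finset_mem_iff [IsNoetherianRing A] (U : (Spec A).Opens) :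
    ∃ s : Finset A, ∀ x : Spec A, x ∈ U ↔ ∃ f ∈ s, f ∉ x.asIdeal := by
  obtain ⟨s, hs⟩ := PrimeSpectrum.isCompact_isOpen_iff.mp
    ⟨TopologicalSpace.NoetherianSpace.isCompact (α := PrimeSpectrum A) U.1, U.2⟩
  refine ⟨s, fun x ↦ ?_⟩
  refine (Set.ext_iff.mp hs x).symm.trans ?_
  exact Set.not_subset

/-- The restriction of `w` to `D(f)` lands in the image of the open immersion `c`, hence factors
through it. -/
lemma exists_localization_chart (w : Spec A ⟶ X) (c : Spec B ⟶ X) [IsOpenImmersion c] (f : A)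
    (hf : ∀ x : Spec A, f ∉ x.asIdeal → w x ∈ c.opensRange) :
    ∃ θ : B ⟶ CommRingCat.of (Localization.Away f),
      Spec.map θ ≫ c = Spec.map (CommRingCat.ofHom (algebraMap A (Localization.Away f))) ≫ w := by
  have : Set.range (Spec.map (CommRingCat.ofHom (algebraMap A (Localization.Away f))) ≫ w) ⊆
      Set.range c := by
    rintro _ ⟨x, rfl⟩
    rw [Scheme.Hom.comp_apply]
    refine hf _ fun h ↦ x.2.ne_top (Ideal.eq_top_of_isUnit_mem _ h ?_)
    exact IsLocalization.Away.algebraMap_isUnit f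
  exact ⟨Spec.preimage (IsOpenImmersion.lift c _ this), by simp [IsOpenImmersion.lift_fac]⟩

/-- The parameters of those points in a family of `K`-points which lie in a chart of `X`. -/
def chartDomain (w : Spec A ⟶ X) (ev : S → (A ⟶ CommRingCat.of K)) (c : Spec B ⟶ X) :
    Set (I → K) :=
  {v | ∃ (h : v ∈ S) (g : B ⟶ CommRingCat.of K), Spec.map g ≫ c = Spec.map (ev ⟨v, h⟩) ≫ w}

/-- The preimage of the chart is a finite union of principal opens `D(f)`, and on `D(f)` the
coordinate `b` pulls back to a fraction `a / f ^ n`. The point is uniformity: `a` and `n` depend on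
`f` and `b` but not on the `K`-point `g`. -/
lemma exists_chart_cover [IsNoetherianRing A] (w : Spec A ⟶ X) (c : Spec B ⟶ X)
    [IsOpenImmersion c] : ∃ s : Finset A,
      (∀ g : A ⟶ CommRingCat.of K, (∃ h : B ⟶ CommRingCat.of K, Spec.map h ≫ c = Spec.map g ≫ w) ↔
        ∃ f ∈ s, g f ≠ 0) ∧
      ∀ f ∈ s, ∀ b : B, ∃ (a : A) (n : ℕ), ∀ (g : A ⟶ CommRingCat.of K)
        (h : B ⟶ CommRingCat.of K), Spec.map h ≫ c = Spec.map g ≫ w → g f ≠ 0 →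
          h b * g f ^ n = g a := by
  obtain ⟨s, hs⟩ := exists_finset_mem_iff (w ⁻¹ᵁ c.opensRange)
  have H (f) (hf : f ∈ s) := exists_localization_chart w c f fun x hx ↦ (hs x).mpr ⟨f, hf, hx⟩
  have key {f} (hf : f ∈ s) (g : A ⟶ CommRingCat.of K) (hg : g f ≠ 0) :
      ∃ l : CommRingCat.of (Localization.Away f) ⟶ CommRingCat.of K,
        (∀ a, l (algebraMap A _ a) = g a) ∧
        Spec.map ((H f hf).choose ≫ l) ≫ c = Spec.map g ≫ w := by
    let l : CommRingCat.of (Localization.Away f) ⟶ CommRingCat.of K :=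
      CommRingCat.ofHom (IsLocalization.Away.lift f (g := g.hom) (IsUnit.mk0 _ hg))
    have hl (a) : l (algebraMap A _ a) = g a := IsLocalization.Away.lift_eq f (IsUnit.mk0 _ hg) a
    refine ⟨l, hl, ?_⟩
    rw [Spec.map_comp, Category.assoc, (H f hf).choose_spec, ← Category.assoc, ← Spec.map_comp]
    congr 2
    ext a
    exact hl a
  refine ⟨s, fun g ↦ ⟨fun ⟨h, e⟩ ↦ ?_, fun ⟨f, hf, hg⟩ ↦ ?_⟩, fun f hf b ↦ ?_⟩
  · let x : Spec (CommRingCat.of K) := IsLocalRing.closedPoint K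
    have hx : w (Spec.map g x) ∈ c.opensRange := by
      rw [← Scheme.Hom.comp_apply, ← e]
      exact ⟨Spec.map h x, rfl⟩
    obtain ⟨f, hf, hfx⟩ := (hs _).mp hx
    refine ⟨f, hf, fun h0 ↦ hfx ?_⟩
    change g f ∈ IsLocalRing.maximalIdeal K
    rw [h0]
    exact zero_mem _
  · obtain ⟨l, -, hl⟩ := key hf g hg
    exact ⟨_, hl⟩
  · obtain ⟨⟨a, _, n, rfl⟩, ha⟩ := IsLocalization.surj (Submonoid.powers f) ((H f hf).choose b)
    refine ⟨a, n, fun g h e hg ↦ ?_⟩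
    obtain ⟨l, hl, e'⟩ := key hf g hg
    have : h = (H f hf).choose ≫ l := by
      rw [← e', cancel_mono] at e
      exact Spec.map_injective e
    have := congr_arg l ha
    simp only [map_mul, map_pow] at this
    rw [hl, hl] at this
    rwa [‹h = _›]

variable [Ring.CompatibleRing K]

lemma definableSet_chartDomain [IsNoetherianRing A] (hS : DefinableSet S) (w : Spec A ⟶ X)
    {ev : S → (A ⟶ CommRingCat.of K)} (hev : ∀ a, PiecewiseRational (ev · a)) (c : Spec B ⟶ X)
    [IsOpenImmersion c] : DefinableSet (chartDomain w ev c) := by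
  obtain ⟨s, hs, -⟩ := exists_chart_cover (K := K) w c
  convert Set.definable_biUnion_finset (fun f ↦ (hev f).definableSet_ne_zero hS) s using 1
  ext v
  simp only [chartDomain, hs, Set.mem_iUnion, Set.mem_ofPred_eq]
  tauto

/-- In a chart the coordinates of a definable family of points are piecewise rational. -/
lemma piecewiseRational_chart [IsNoetherianRing A] (hS : DefinableSet S) (w : Spec A ⟶ X)
    {ev : S → (A ⟶ CommRingCat.of K)} (hev : ∀ a, PiecewiseRational (ev · a)) (c : Spec B ⟶ X)
    [IsOpenImmersion c] {T : Set (I → K)} (hT : T ⊆ S) {ev' : T → (B ⟶ CommRingCat.of K)}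
    (h : ∀ v, Spec.map (ev' v) ≫ c = Spec.map (ev (Set.inclusion hT v)) ≫ w) (b : B) :
    PiecewiseRational (ev' · b) := by
  obtain ⟨s, hs, hs'⟩ := exists_chart_cover (K := K) w c
  refine .of_cover (ι := s) (fun f ↦ (hev f).definableSet_ne_zero hS) (fun v hv ↦ ?_) fun f ↦ ?_
  · obtain ⟨f, hf, hf'⟩ := (hs (ev ⟨v, hT hv⟩)).mp ⟨_, h ⟨v, hv⟩⟩
    exact Set.mem_iUnion.mpr ⟨⟨f, hf⟩, hT hv, hf'⟩
  · obtain ⟨a, n, han⟩ := hs' f f.2 b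
    refine ⟨_, _, (hev a).comp_inclusion hT, ((hev f).pow n).comp_inclusion hT,
      fun v ⟨h₁, h₂⟩ ↦ ⟨pow_ne_zero n h₂, han _ _ (h v) h₂⟩⟩

end Charts

namespace ProjectiveBundle

open CategoryTheory Limits AlgebraicGeometry MvPolynomial HomogeneousLocalization

noncomputable section

attribute [local instance] MvPolynomial.gradedAlgebra

/-! ### Field-valued points of projective space -/

section Points

variable {n : ℕ} {A : CommRingCat.{u}} {K : Type u} [Field K]

/-- The standard affine chart `D₊(x_l)` of projective space. -/
def stdChart (A : CommRingCat.{u}) (l : Fin n) :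
    Spec (CommRingCat.of (Away (homogeneousSubmodule (Fin n) A) (X l))) ⟶ projSpace n A :=
  Proj.awayι (homogeneousSubmodule (Fin n) A) (X l) (X_mem l) one_pos

instance (l : Fin n) : IsOpenImmersion (stdChart A l) :=
  inferInstanceAs (IsOpenImmersion (Proj.awayι _ _ _ _))

lemma stdChart_toSpec (l : Fin n) :
    stdChart A l ≫ projSpaceToSpec n A = Spec.map (CommRingCat.ofHom (awayStr (X l))) :=
  awayι_projSpaceToSpec _ _

lemma mem_opensRange_stdChart_iff (l j : Fin n)
    (x : Spec (CommRingCat.of (Away (homogeneousSubmodule (Fin n) A) (X l)))) :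
    stdChart A l x ∈ (stdChart A j).opensRange ↔ awayFrac (X_mem l) j ∉ x.asIdeal := by
  have h : Away.isLocalizationElem (X_mem l) (X_mem (A := A) j) = awayFrac (X_mem l) j := by
    simp only [Away.isLocalizationElem, awayFrac, pow_one]
  have hr : (stdChart A j).opensRange = Proj.basicOpen _ (X j) := Proj.opensRange_awayι _ _ _ _
  rw [← h, hr]
  change x ∈ Proj.awayι _ _ _ _ ⁻¹ᵁ Proj.basicOpen _ _ ↔ _
  rw [Proj.awayι_preimage_basicOpen _ (X_mem l) one_pos (X_mem j) one_pos]
  rfl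

lemma exists_mem_opensRange_stdChart (x : projSpace n A) :
    ∃ l, x ∈ (stdChart A l).opensRange := by
  obtain ⟨y, hy⟩ := (stdCover n A).covers x
  exact ⟨_, y, hy⟩

lemma awayFrac_self (l : Fin n) : awayFrac (X_mem (A := A) l) l = 1 := by
  ext
  rw [awayFrac, Away.val_mk, val_one]
  simp only [pow_one]
  exact Localization.mk_self (⟨X l, 1, pow_one _⟩ : Submonoid.powers (X l : MvPolynomial (Fin n) A))

lemma exists_away_hom_X (ψ : A ⟶ CommRingCat.of K) {x : Fin n → K} {l : Fin n} (h : x l = 1) :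
    ∃ f : Away (homogeneousSubmodule (Fin n) A) (X l) →+* K,
      (∀ a, f (awayStr (X l) a) = ψ a) ∧ ∀ j, f (awayFrac (X_mem l) j) = x j :=
  exists_away_hom (X_mem l) ψ.hom x (by simpa using h)

/-- Evaluation at the point with homogeneous coordinates `x`, where `x_l = 1`, of the functions on
the chart `D₊(x_l)`. -/
def chartEval (ψ : A ⟶ CommRingCat.of K) {x : Fin n → K} {l : Fin n} (h : x l = 1) :
    CommRingCat.of (Away (homogeneousSubmodule (Fin n) A) (X l)) ⟶ CommRingCat.of K :=
  CommRingCat.ofHom (exists_away_hom_X ψ h).choose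

variable (ψ : A ⟶ CommRingCat.of K) {x y : Fin n → K} {l j : Fin n}

lemma chartEval_awayStr (h : x l = 1) (a : A) : chartEval ψ h (awayStr (X l) a) = ψ a :=
  (exists_away_hom_X ψ h).choose_spec.1 a

lemma chartEval_awayFrac (h : x l = 1) (j : Fin n) :
    chartEval ψ h (awayFrac (X_mem l) j) = x j :=
  (exists_away_hom_X ψ h).choose_spec.2 j

lemma exists_eq_eval₂Hom {s : MvPolynomial (Fin n) A} (hs : s ∈ homogeneousSubmodule (Fin n) A 1)
    (z : Away (homogeneousSubmodule (Fin n) A) s) :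
    ∃ p : MvPolynomial (Fin n) A, z = eval₂Hom (awayStr s) (awayFrac hs) p := by
  obtain ⟨m, p, hp, rfl⟩ := Away.mk_surjective _ hs z
  exact ⟨p, away_mk_eq hs m p hp⟩

lemma chartEval_eval₂Hom (h : x l = 1) (p : MvPolynomial (Fin n) A) :
    chartEval ψ h (eval₂Hom (awayStr (X l)) (awayFrac (X_mem l)) p) = eval₂Hom ψ.hom x p := by
  have : (chartEval ψ h).hom.comp (eval₂Hom (awayStr (X l)) (awayFrac (X_mem l))) =
      eval₂Hom ψ.hom x :=
    MvPolynomial.ringHom_ext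
      (fun a ↦ by simpa using! chartEval_awayStr ψ h a)
      (fun j ↦ by simpa using! chartEval_awayFrac ψ h j)
  exact congr($this p)

/-- The point of projective space with homogeneous coordinates `x`, where `x_l = 1`. -/
def chartPoint (h : x l = 1) : Spec (CommRingCat.of K) ⟶ projSpace n A :=
  Spec.map (chartEval ψ h) ≫ stdChart A l

lemma chartPoint_toSpec (h : x l = 1) :
    chartPoint ψ h ≫ projSpaceToSpec n A = Spec.map ψ := by
  rw [chartPoint, Category.assoc, stdChart_toSpec, ← Spec.map_comp]
  congr 1
  ext a
  exact chartEval_awayStr ψ h a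

/-- The underlying point of a morphism from the spectrum of a field. -/
def fieldPoint {Y : Scheme.{u}} (f : Spec (CommRingCat.of K) ⟶ Y) : Y :=
  f (IsLocalRing.closedPoint K : Spec (CommRingCat.of K))

lemma fieldPoint_comp {Y Z : Scheme.{u}} (f : Spec (CommRingCat.of K) ⟶ Y) (g : Y ⟶ Z) :
    fieldPoint (f ≫ g) = g (fieldPoint f) :=
  Scheme.Hom.comp_apply _ _ _

lemma mem_asIdeal_fieldPoint_iff {B : CommRingCat.{u}} (g : B ⟶ CommRingCat.of K) (b : B) :
    b ∈ (fieldPoint (Spec.map g)).asIdeal ↔ g b = 0 := by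
  change g b ∈ IsLocalRing.maximalIdeal K ↔ _
  rw [IsLocalRing.maximalIdeal_eq_bot, Ideal.mem_bot]

lemma exists_factorization {B : CommRingCat.{u}} {Y : Scheme.{u}} (c : Spec B ⟶ Y)
    [IsOpenImmersion c] (f : Spec (CommRingCat.of K) ⟶ Y) (h : fieldPoint f ∈ c.opensRange) :
    ∃ g : B ⟶ CommRingCat.of K, Spec.map g ≫ c = f := by
  have : Set.range f ⊆ Set.range c := by
    rintro _ ⟨x, rfl⟩
    have : x = (IsLocalRing.closedPoint K : Spec (CommRingCat.of K)) :=
      Subsingleton.elim (α := PrimeSpectrum K) _ _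
    rw [this]
    exact h
  exact ⟨Spec.preimage (IsOpenImmersion.lift c f this), by simp [IsOpenImmersion.lift_fac]⟩

lemma fieldPoint_chartPoint_mem_iff (h : x l = 1) (j : Fin n) :
    fieldPoint (chartPoint ψ h) ∈ (stdChart A j).opensRange ↔ x j ≠ 0 := by
  rw [chartPoint, fieldPoint_comp, mem_opensRange_stdChart_iff, mem_asIdeal_fieldPoint_iff,
    chartEval_awayFrac]

/-- The first nonzero coordinate of `x` has index `l` and is equal to `1`. -/
def IsLeading (x : Fin n → K) (l : Fin n) : Prop := x l = 1 ∧ ∀ j < l, x j = 0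

lemma IsLeading.eq (h : IsLeading x l) (h' : IsLeading x j) : l = j := by
  rcases lt_trichotomy l j with hlt | hlt | hlt
  · exact absurd ((h.1.symm.trans (h'.2 l hlt))) one_ne_zero
  · exact hlt
  · exact absurd ((h'.1.symm.trans (h.2 j hlt))) one_ne_zero

/-- The point of projective space with normalized homogeneous coordinates `x`. -/
def projPoint (hx : IsNormalized x) : Spec (CommRingCat.of K) ⟶ projSpace n A :=
  chartPoint ψ hx.choose_spec.1

lemma projPoint_eq (hx : IsNormalized x) (h : IsLeading x l) :
    projPoint ψ hx = chartPoint ψ h.1 := by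
  obtain rfl : hx.choose = l := IsLeading.eq hx.choose_spec h
  rfl

lemma projPoint_toSpec (hx : IsNormalized x) :
    projPoint ψ hx ≫ projSpaceToSpec n A = Spec.map ψ :=
  chartPoint_toSpec ψ _

/-- The standard charts containing the point reveal which coordinates are nonzero, hence the leading
index; in that chart the coordinates are the values of the functions `x_i / x_l`. -/
lemma projPoint_injective (hx : IsNormalized x) (hy : IsNormalized y)
    (e : projPoint ψ hx = projPoint ψ hy) : x = y := by
  obtain ⟨l, hl⟩ := id hx
  obtain ⟨j, hj⟩ := id hy
  rw [projPoint_eq ψ hx hl, projPoint_eq ψ hy hj] at e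
  have key (i) : x i ≠ 0 ↔ y i ≠ 0 := by
    rw [← fieldPoint_chartPoint_mem_iff ψ hl.1, e, fieldPoint_chartPoint_mem_iff]
  obtain rfl : l = j := by
    rcases lt_trichotomy l j with h | h | h
    · exact absurd (hj.2 l h) ((key l).mp (hl.1 ▸ one_ne_zero))
    · exact h
    · exact absurd (hl.2 j h) ((key j).mpr (hj.1 ▸ one_ne_zero))
  rw [chartPoint, chartPoint, cancel_mono] at e
  have e := Spec.map_injective e
  ext i
  rw [← chartEval_awayFrac ψ hl.1 i, e, chartEval_awayFrac]

lemma exists_projPoint_eq (f : Spec (CommRingCat.of K) ⟶ projSpace n A)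
    (hf : f ≫ projSpaceToSpec n A = Spec.map ψ) :
    ∃ (x : Fin n → K) (hx : IsNormalized x), projPoint ψ hx = f := by
  have hex := exists_mem_opensRange_stdChart (fieldPoint f)
  -- Taking the smallest chart that contains the point makes the coordinates before `l` vanish, so
  -- the vector of values of `x_j / x_l` is normalized.
  obtain ⟨l, hl, hmin⟩ := WellFounded.has_min (wellFounded_lt (α := Fin n))
    {l | fieldPoint f ∈ (stdChart A l).opensRange} hex
  obtain ⟨g, rfl⟩ := exists_factorization (stdChart A l) f hl
  let x : Fin n → K := fun j ↦ g (awayFrac (X_mem l) j)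
  have h1 : x l = 1 := by simp only [x, awayFrac_self, map_one]
  have hg : chartEval ψ h1 = g := by
    ext1
    refine away_hom_ext (X_mem l) (fun a ↦ ?_) fun j ↦ chartEval_awayFrac ψ h1 j
    rw [Category.assoc, stdChart_toSpec, ← Spec.map_comp] at hf
    exact (chartEval_awayStr ψ h1 a).trans congr($(Spec.map_injective hf).hom a).symm
  have hlead : IsLeading x l := by
    refine ⟨h1, fun j hj ↦ by_contra fun h0 ↦ hmin j ?_ hj⟩
    rw [← hg]
    exact (fieldPoint_chartPoint_mem_iff ψ h1 j).mpr h0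
  refine ⟨x, ⟨l, hlead⟩, (projPoint_eq ψ ⟨l, hlead⟩ hlead).trans ?_⟩
  rw [chartPoint, hg]

lemma piecewiseRational_chartEval [FirstOrder.Ring.CompatibleRing K] {I : Type*}
    {S : Set (I → K)} {ψ : S → (A ⟶ CommRingCat.of K)} (hψ : ∀ a, PiecewiseRational (ψ · a))
    {x : S → Fin n → K} (hx : ∀ j, PiecewiseRational (x · j)) (h : ∀ v, x v l = 1)
    (z : Away (homogeneousSubmodule (Fin n) A) (X l)) :
    PiecewiseRational fun v ↦ chartEval (ψ v) (h v) z := by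
  obtain ⟨p, rfl⟩ := exists_eq_eval₂Hom (X_mem l) z
  exact (congr_arg PiecewiseRational (funext fun v ↦ chartEval_eval₂Hom (ψ v) (h v) p)).mpr
    (.eval₂Hom hψ hx p)

instance : IsZariskiLocalAtSource @LocallyOfFiniteType.{u} :=
  HasRingHomProperty.instIsZariskiLocalAtSource

/-- The chart ring is a quotient of `A[x]`. Finite type is needed twice later: for Noetherian charts
and for finitely many coordinates on them. -/
lemma locallyOfFiniteType_stdChart_toSpec (l : Fin n) :
    LocallyOfFiniteType (stdChart A l ≫ projSpaceToSpec n A) := by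
  rw [stdChart_toSpec, HasRingHomProperty.Spec_iff (P := @LocallyOfFiniteType)]
  have h : (eval₂Hom (awayStr (X l)) (awayFrac (X_mem (A := A) l))).comp C = awayStr (X l) :=
    RingHom.ext fun a ↦ by simp
  change (awayStr (X l)).FiniteType
  rw [← h]
  refine .comp (.of_surjective _ fun z ↦ ?_) ?_
  · obtain ⟨p, hp⟩ := exists_eq_eval₂Hom (X_mem l) z
    exact ⟨p, hp.symm⟩
  · exact RingHom.finiteType_algebraMap.mpr inferInstance

instance : LocallyOfFiniteType (projSpaceToSpec n A) :=
  IsZariskiLocalAtSource.of_openCover (P := @LocallyOfFiniteType.{u}) (stdCover n A).openCover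
    fun l ↦ locallyOfFiniteType_stdChart_toSpec l

end Points

/-! ### Field-valued points of projective bundles -/

section BundlePoints

variable {X : Scheme.{u}} {m : ℕ} (E : VectorBundle X m) {K : Type u} [Field K]

/-- The open subscheme `ℙ^{m-1}_U` of the projective bundle, for a frame over `U`. -/
def VectorBundle.projChart (i : LocalFrame E) : projSpace m Γ(X, i.U) ⟶ E.proj :=
  colimit.ι E.projGluingData.functor i

instance (i : LocalFrame E) : IsOpenImmersion (E.projChart i) :=
  E.projGluingData.cover.map_prop i

lemma VectorBundle.isPullback_projChart (i : LocalFrame E) :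
    IsPullback (projSpaceToSpec m Γ(X, i.U)) (E.projChart i) i.isAffineOpen.fromSpec
      E.projToBase :=
  E.projGluingData.isPullback_natTrans_ι_toBase i

lemma VectorBundle.projChart_toBase (i : LocalFrame E) :
    E.projChart i ≫ E.projToBase = projSpaceToSpec m Γ(X, i.U) ≫ i.isAffineOpen.fromSpec :=
  (E.isPullback_projChart i).w.symm

lemma VectorBundle.locallyOfFiniteType_projChart_toBase (i : LocalFrame E) :
    LocallyOfFiniteType (E.projChart i ≫ E.projToBase) := by
  rw [E.projChart_toBase]
  infer_instance

instance : LocallyOfFiniteType E.projToBase :=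
  IsZariskiLocalAtSource.of_openCover (P := @LocallyOfFiniteType.{u})
    E.projGluingData.cover fun i ↦ E.locallyOfFiniteType_projChart_toBase i

/-- The point of a projective bundle with normalized homogeneous coordinates `y` with respect to
a frame, in the fibre over the point given by `ψ`. -/
def bundlePoint (i : LocalFrame E) (ψ : Γ(X, i.U) ⟶ CommRingCat.of K) {y : Fin m → K}
    (hy : IsNormalized y) : Spec (CommRingCat.of K) ⟶ E.proj :=
  projPoint ψ hy ≫ E.projChart i

variable {E} {i : LocalFrame E} {ψ : Γ(X, i.U) ⟶ CommRingCat.of K} {y z : Fin m → K}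

lemma bundlePoint_toBase (hy : IsNormalized y) :
    bundlePoint E i ψ hy ≫ E.projToBase = Spec.map ψ ≫ i.isAffineOpen.fromSpec := by
  rw [bundlePoint, Category.assoc, E.projChart_toBase, ← Category.assoc, projPoint_toSpec]

lemma bundlePoint_injective (hy : IsNormalized y) (hz : IsNormalized z)
    (h : bundlePoint E i ψ hy = bundlePoint E i ψ hz) : y = z := by
  rw [bundlePoint, bundlePoint, cancel_mono] at h
  exact projPoint_injective ψ hy hz h

/-- Over the domain `U` of the frame the bundle is the pullback `ℙ^{m-1}_U`, so a point above `U`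
lifts there and has normalized coordinates. -/
lemma exists_bundlePoint_eq (f : Spec (CommRingCat.of K) ⟶ E.proj)
    (hf : f ≫ E.projToBase = Spec.map ψ ≫ i.isAffineOpen.fromSpec) :
    ∃ (y : Fin m → K) (hy : IsNormalized y), bundlePoint E i ψ hy = f := by
  obtain ⟨y, hy, e⟩ := exists_projPoint_eq ψ ((E.isPullback_projChart i).lift _ _ hf.symm)
    ((E.isPullback_projChart i).lift_fst _ _ _)
  exact ⟨y, hy, by rw [bundlePoint, e, IsPullback.lift_snd]⟩

lemma VectorBundle.exists_finite_frames [CompactSpace X] (E : VectorBundle X m) :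
    ∃ (r : ℕ) (e : Fin r → LocalFrame E), ∀ x : X, ∃ k, x ∈ (e k).U := by
  obtain ⟨s, hs⟩ := isCompact_univ.elim_finite_subcover
    (fun i : LocalFrame E ↦ (i.U : Set X)) (fun i ↦ i.U.isOpen) fun x _ ↦ by
      obtain ⟨i, hi, -⟩ := E.exists_localFrame (show x ∈ (⊤ : X.Opens) from trivial)
      exact Set.mem_iUnion.mpr ⟨i, hi⟩
  refine ⟨s.card, fun k ↦ (s.equivFin.symm k).1, fun x ↦ ?_⟩
  obtain ⟨i, hi, hx⟩ := Set.mem_iUnion₂.mp (hs (Set.mem_univ x))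
  exact ⟨s.equivFin ⟨i, hi⟩, by simpa using hx⟩

lemma compactSpace_projSpace (n : ℕ) (A : CommRingCat.{u}) : CompactSpace (projSpace n A) :=
  have : Finite (stdCover n A).openCover.I₀ := inferInstanceAs (Finite (Fin n))
  have (k : (stdCover n A).openCover.I₀) : CompactSpace ((stdCover n A).openCover.X k) :=
    inferInstanceAs (CompactSpace (Spec ((stdCover n A).X k)))
  Scheme.OpenCover.compactSpace (stdCover n A).openCover

end BundlePoints

/-! ### Definable families of points and graphs of morphisms -/

section DefinableFamilies

variable {I J : Type*} {F K : Type u} [Field F] [Field K]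
  {S : Set (I → K)} {T : Set (J → K)} {Y Z : Scheme.{u}}

lemma isNoetherianRing_of_chart {A : CommRingCat.{u}} (s : Y ⟶ Spec (CommRingCat.of F))
    [LocallyOfFiniteType s] (c : Spec A ⟶ Y) [IsOpenImmersion c] : IsNoetherianRing A := by
  obtain ⟨φ, hφ⟩ := Spec.map_surjective (c ≫ s)
  have h : LocallyOfFiniteType (Spec.map φ) := hφ ▸ inferInstance
  rw [HasRingHomProperty.Spec_iff (P := @LocallyOfFiniteType)] at h
  let _ := φ.hom.toAlgebra
  have : Algebra.FiniteType F A := h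
  exact Algebra.FiniteType.isNoetherianRing F A

/-- `A` is finitely generated over `F`, so equality of two `K`-points inducing the same map `F → K`
is a finite conjunction of equations. -/
lemma exists_finset_chart_coordinates {A : CommRingCat.{u}} (s : Y ⟶ Spec (CommRingCat.of F))
    [LocallyOfFiniteType s] (c : Spec A ⟶ Y) [IsOpenImmersion c] :
    ∃ t : Finset A, ∀ g h : A ⟶ CommRingCat.of K,
      Spec.map g ≫ c ≫ s = Spec.map h ≫ c ≫ s → (∀ b ∈ t, g b = h b) → g = h := by
  obtain ⟨φ, hφ⟩ := Spec.map_surjective (c ≫ s)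
  have h : LocallyOfFiniteType (Spec.map φ) := hφ ▸ inferInstance
  rw [HasRingHomProperty.Spec_iff (P := @LocallyOfFiniteType)] at h
  let _ := φ.hom.toAlgebra
  obtain ⟨t, ht⟩ := (h : Algebra.FiniteType F A).out
  refine ⟨t, fun g h e hb ↦ ?_⟩
  rw [← hφ, ← Spec.map_comp, ← Spec.map_comp] at e
  have e := Spec.map_injective e
  ext x
  have hx : x ∈ Algebra.adjoin F (t : Set A) := ht ▸ trivial
  induction hx using Algebra.adjoin_induction with
  | mem x hx => exact hb x hx
  | algebraMap r => exact congr($(e).hom r)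
  | add x y _ _ hx hy => simp only [map_add, hx, hy]
  | mul x y _ _ hx hy => simp only [map_mul, hx, hy]

variable [FirstOrder.Ring.CompatibleRing K]

/-- A family of `K`-points of a scheme is definable if it is piecewise given by families of points
of affine charts whose coordinates are definable functions of the parameter. -/
def IsDefinableFamily (α : S → (Spec (CommRingCat.of K) ⟶ Y)) : Prop :=
  ∃ (ι : Type) (_ : Finite ι) (P : ι → Set (I → K)) (hP : ∀ k, P k ⊆ S),
    (∀ k, DefinableSet (P k)) ∧ S ⊆ ⋃ k, P k ∧
      ∀ k, ∃ (A : CommRingCat.{u}) (c : Spec A ⟶ Y) (_ : IsOpenImmersion c)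
        (ev : P k → (A ⟶ CommRingCat.of K)), (∀ a, PiecewiseRational (ev · a)) ∧
          ∀ v, α (Set.inclusion (hP k) v) = Spec.map (ev v) ≫ c

/-- The graph of a morphism of schemes in terms of definable families of points is definable. -/
lemma definableSet_graph (φ : Y ⟶ Z) (s : Y ⟶ Spec (CommRingCat.of F))
    (t : Z ⟶ Spec (CommRingCat.of F)) [LocallyOfFiniteType s] [LocallyOfFiniteType t]
    (hφ : φ ≫ t = s) {α : S → (Spec (CommRingCat.of K) ⟶ Y)}
    {β : T → (Spec (CommRingCat.of K) ⟶ Z)} (hα : IsDefinableFamily α) (hβ : IsDefinableFamily β)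
    {ψ : CommRingCat.of F ⟶ CommRingCat.of K} (hαs : ∀ v, α v ≫ s = Spec.map ψ)
    (hβt : ∀ w, β w ≫ t = Spec.map ψ) :
    DefinableSet {z : I ⊕ J → K | ∃ (h : z ∘ Sum.inl ∈ S) (h' : z ∘ Sum.inr ∈ T),
      α ⟨_, h⟩ ≫ φ = β ⟨_, h'⟩} := by
  obtain ⟨ι, _, P, hPS, hP, hSP, H⟩ := hα
  obtain ⟨κ, _, Q, hQT, hQ, hTQ, H'⟩ := hβ
  choose A c hc ev hev hevα using H
  choose B d hd ev' hev' hevβ using H'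
  let R (k : ι × κ) : Set (I ⊕ J → K) := {z | z ∘ Sum.inl ∈ P k.1 ∧ z ∘ Sum.inr ∈ Q k.2}
  have hR (k) : DefinableSet (R k) :=
    ((hP k.1).preimage_comp Sum.inl).inter ((hQ k.2).preimage_comp Sum.inr)
  let ε (k : ι × κ) (z : R k) : A k.1 ⟶ CommRingCat.of K := ev k.1 ⟨z.1 ∘ Sum.inl, z.2.1⟩
  let ε' (k : ι × κ) (z : R k) : B k.2 ⟶ CommRingCat.of K := ev' k.2 ⟨z.1 ∘ Sum.inr, z.2.2⟩
  have hε (k) (a) : PiecewiseRational (ε k · a) :=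
    (hev k.1 a).comp_reindex Sum.inl fun z hz ↦ hz.1
  have hε' (k) (b) : PiecewiseRational (ε' k · b) :=
    (hev' k.2 b).comp_reindex Sum.inr fun z hz ↦ hz.2
  -- The part of the piece `R k` on which the image under `φ` of the first point lies in the chart
  -- of the second; `g` will be the coordinates of that image.
  let D (k : ι × κ) := chartDomain (c k.1 ≫ φ) (ε k) (d k.2)
  have hA (k) := isNoetherianRing_of_chart s (c k)
  have hD (k) : DefinableSet (D k) := definableSet_chartDomain (hR k) _ (hε k) _
  have hDR (k) : D k ⊆ R k := fun z hz ↦ hz.1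
  have hg (k) (z : D k) := z.2.2
  choose g hgz using hg
  have hgPR (k) (b) : PiecewiseRational (g k · b) :=
    piecewiseRational_chart (hR k) (c k.1 ≫ φ) (hε k) (d k.2) (hDR k) (hgz k) b
  choose G hG using fun k ↦ exists_finset_chart_coordinates (K := K) t (d k)
  have hdef (k) (b) : DefinableSet {z | ∃ h : z ∈ D k,
      g k ⟨z, h⟩ b - ε' k (Set.inclusion (hDR k) ⟨z, h⟩) b = 0} :=
    ((hgPR k b).sub ((hε' k b).comp_inclusion (hDR k))).definableSet_eq_zero (hD k)
  -- On each `D k` the graph is cut out by equating the values of `g k` and `ε' k` on a finite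
  -- generating set.
  convert Set.definable_iUnion_of_finite fun k ↦ (hD k).inter
    (Set.definable_biInter_finset (fun b ↦ hdef k b) (G k.2)) using 1
  ext z
  simp only [Set.mem_iUnion, Set.mem_inter_iff, Set.mem_iInter]
  constructor
  · rintro ⟨h, h', e⟩
    obtain ⟨k, hk⟩ := Set.mem_iUnion.mp (hSP h)
    obtain ⟨k', hk'⟩ := Set.mem_iUnion.mp (hTQ h')
    have e' : Spec.map (ε' (k, k') ⟨z, hk, hk'⟩) ≫ d k' =
        Spec.map (ε (k, k') ⟨z, hk, hk'⟩) ≫ c k ≫ φ := by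
      have h₁ := hevα k ⟨_, hk⟩
      have h₂ := hevβ k' ⟨_, hk'⟩
      rw [← Category.assoc]
      exact h₂.symm.trans (e.symm.trans (congr_arg (· ≫ φ) h₁))
    have hz : z ∈ D (k, k') := ⟨⟨hk, hk'⟩, _, e'⟩
    refine ⟨(k, k'), hz, fun b _ ↦ ⟨hz, ?_⟩⟩
    have : g (k, k') ⟨z, hz⟩ = ε' (k, k') ⟨z, hk, hk'⟩ := by
      have := (hgz (k, k') ⟨z, hz⟩).trans e'.symm
      rw [cancel_mono] at this
      exact Spec.map_injective this
    rw [this]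
    exact sub_self _
  · rintro ⟨k, hz, hb⟩
    have hk := (hDR k hz).1
    have hk' := (hDR k hz).2
    have h₁ := hevα k.1 ⟨_, hk⟩
    have h₂ := hevβ k.2 ⟨_, hk'⟩
    have h₃ := hgz k ⟨z, hz⟩
    refine ⟨hPS k.1 hk, hQT k.2 hk', ?_⟩
    have h₄ : α ⟨z ∘ Sum.inl, hPS k.1 hk⟩ ≫ φ = Spec.map (g k ⟨z, hz⟩) ≫ d k.2 := by
      rw [h₃, ← Category.assoc]
      exact congr_arg (· ≫ φ) h₁
    have : g k ⟨z, hz⟩ = ε' k ⟨z, hk, hk'⟩ := by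
      refine hG k.2 _ _ ?_ fun b hbG ↦ sub_eq_zero.mp (hb b hbG).2
      have h₅ : Spec.map (g k ⟨z, hz⟩) ≫ d k.2 ≫ t = Spec.map ψ := by
        rw [← Category.assoc, ← h₄, Category.assoc, hφ, hαs]
      exact h₅.trans ((hβt _).symm.trans ((congr_arg (· ≫ t) h₂).trans (Category.assoc _ _ _)))
    rw [h₄, this]
    exact h₂.symm

end DefinableFamilies

/-! ### Definable parametrization of the points of a projective bundle -/

section Parametrization

variable {F K : Type u} [Field F] [Field K] {a m : ℕ}

lemma definableSet_isLeading [FirstOrder.Ring.CompatibleRing K] {I : Type*} {n : ℕ}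
    (f : Fin n → I) (l : Fin n) : DefinableSet {v : I → K | IsLeading (v ∘ f) l} := by
  have h (p : MvPolynomial I K) := DefinableSet.eval_eq_zero p
  convert (h (X (f l) - 1)).inter
    (Set.definable_iInter_of_finite fun j : {j // j < l} ↦ h (X (f j))) using 1
  ext v
  simp [IsLeading, sub_eq_zero]

/-- The `K`-points of a projective bundle over a projective space are parametrized by pairs of
normalized vectors, in a definable way. -/
theorem exists_parametrization [FirstOrder.Ring.CompatibleRing K]
    (ψ₀ : CommRingCat.of F ⟶ CommRingCat.of K)
    (E : VectorBundle (projSpace a (CommRingCat.of F)) m) :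
    ∃ α : normalizedPairs a m K → (Spec (CommRingCat.of K) ⟶ E.proj),
      IsDefinableFamily α ∧ Function.Injective α ∧
      (∀ v, α v ≫ E.projToBase ≫ projSpaceToSpec a (CommRingCat.of F) = Spec.map ψ₀) ∧
      ∀ f : Spec (CommRingCat.of K) ⟶ E.proj,
        f ≫ E.projToBase ≫ projSpaceToSpec a (CommRingCat.of F) = Spec.map ψ₀ → ∃ v, α v = f := by
  have := compactSpace_projSpace a (CommRingCat.of F)
  obtain ⟨r, e, he⟩ := E.exists_finite_frames
  -- Frame domains overlap, and coordinates depend on the frame. Always using the first frame whose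
  -- domain contains the base point makes the parametrization single-valued.
  have hsel (p : Spec (CommRingCat.of K) ⟶ projSpace a (CommRingCat.of F)) :
      ∃ k, fieldPoint p ∈ (e k).U ∧ ∀ k' < k, fieldPoint p ∉ (e k').U := by
    obtain ⟨k, hk, hmin⟩ := WellFounded.has_min (wellFounded_lt (α := Fin r))
      {k | fieldPoint p ∈ (e k).U} (he _)
    exact ⟨k, hk, fun k' hk' h ↦ hmin k' h hk'⟩
  choose sel hsel hmin using hsel
  have hfac (p : Spec (CommRingCat.of K) ⟶ projSpace a (CommRingCat.of F)) (k : Fin r) :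
      fieldPoint p ∈ (e k).U ↔
        ∃ g : Γ(projSpace a (CommRingCat.of F), (e k).U) ⟶ CommRingCat.of K, Spec.map g ≫ (e k).isAffineOpen.fromSpec = p := by
    have hr := (e k).isAffineOpen.opensRange_fromSpec
    refine ⟨fun h ↦ exists_factorization _ p (hr.ge h), ?_⟩
    rintro ⟨g, rfl⟩
    rw [fieldPoint_comp]
    exact hr.le ⟨_, rfl⟩
  choose ψ hψ using fun p ↦ (hfac p (sel p)).mp (hsel p)
  let base (v : normalizedPairs a m K) := projPoint ψ₀ v.2.1
  let α (v : normalizedPairs a m K) := bundlePoint E (e (sel (base v))) (ψ (base v)) v.2.2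
  have hα (v) : α v ≫ E.projToBase = base v := (bundlePoint_toBase _).trans (hψ _)
  -- The factorization of the base point through the chart is unique, so any other one, in
  -- particular a piecewise rational one, computes the same `α v`.
  have hαψ (v) (k) (hk : k = sel (base v)) (g : Γ(projSpace a (CommRingCat.of F), (e k).U) ⟶ CommRingCat.of K)
      (hg : Spec.map g ≫ (e k).isAffineOpen.fromSpec = base v) :
      α v = bundlePoint E (e k) g v.2.2 := by
    subst hk
    have := hg.trans (hψ _).symm
    rw [cancel_mono] at this
    rw [Spec.map_injective this]
  refine ⟨α, ?_, fun v w h ↦ ?_, fun v ↦ ?_, fun f hf ↦ ?_⟩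
  · let S (k : Fin a × Fin m) : Set (Fin a ⊕ Fin m → K) :=
      {v | IsLeading (v ∘ Sum.inl) k.1} ∩ {v | IsLeading (v ∘ Sum.inr) k.2}
    have hS (k) : DefinableSet (S k) :=
      (definableSet_isLeading _ _).inter (definableSet_isLeading _ _)
    have hSN (k) : S k ⊆ normalizedPairs a m K := fun v hv ↦ ⟨⟨_, hv.1⟩, ⟨_, hv.2⟩⟩
    let ev (k) (v : S k) := chartEval ψ₀ v.2.1.1
    have hev (k) (z) : PiecewiseRational (ev k · z) :=
      piecewiseRational_chartEval (fun _ ↦ .const _) (fun j ↦ .coord (Sum.inl j)) _ z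
    have hbase (k) (v : S k) :
        base (Set.inclusion (hSN k) v) = Spec.map (ev k v) ≫ stdChart _ k.1 :=
      projPoint_eq ψ₀ _ v.2.1
    let D (k : Fin a × Fin m) (i : Fin r) : Set (Fin a ⊕ Fin m → K) :=
      chartDomain (stdChart _ k.1) (ev k) (e i).isAffineOpen.fromSpec
    have hA (l : Fin a) := isNoetherianRing_of_chart (projSpaceToSpec a (CommRingCat.of F))
      (stdChart _ l)
    have hD (k i) : DefinableSet (D k i) := definableSet_chartDomain (hS k) _ (hev k) _
    have hDmem (k i) (v : S k) : v.1 ∈ D k i ↔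
        fieldPoint (base (Set.inclusion (hSN k) v)) ∈ (e i).U := by
      rw [hfac, hbase]
      exact ⟨fun ⟨_, h⟩ ↦ h, fun h ↦ ⟨v.2, h⟩⟩
    -- On this piece both leading indices are fixed and `k.2` is the selected frame: the base point
    -- lies in its domain and in no earlier one.
    let P (k : (Fin a × Fin m) × Fin r) : Set (Fin a ⊕ Fin m → K) :=
      D k.1 k.2 \ ⋃ i : {i // i < k.2}, D k.1 i
    have hPS (k) : P k ⊆ S k.1 := fun v hv ↦ hv.1.1
    refine ⟨(Fin a × Fin m) × Fin r, inferInstance, P, fun k ↦ (hPS k).trans (hSN k.1),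
      fun k ↦ (hD _ _).sdiff (Set.definable_iUnion_of_finite fun i ↦ hD _ _), fun v hv ↦ ?_,
      fun k ↦ ?_⟩
    · obtain ⟨l, hl⟩ := hv.1
      obtain ⟨j, hj⟩ := hv.2
      let v' : S (l, j) := ⟨v, hl, hj⟩
      refine Set.mem_iUnion.mpr ⟨((l, j), sel (base ⟨v, hv⟩)),
        (hDmem (l, j) _ v').mpr (hsel _), fun h ↦ ?_⟩
      obtain ⟨⟨i, hi⟩, h⟩ := Set.mem_iUnion.mp h
      exact hmin _ i hi ((hDmem (l, j) i v').mp h)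
    · choose g hg using fun v : P k ↦ v.2.1.2
      have hgPR (b) : PiecewiseRational (g · b) :=
        piecewiseRational_chart (hS k.1) _ (hev k.1) _ (hPS k) hg b
      refine ⟨_, stdChart _ k.1.2 ≫ E.projChart (e k.2), inferInstance,
        fun v ↦ chartEval (g v) (hPS k v.2).2.1, fun z ↦
          piecewiseRational_chartEval hgPR (fun j ↦ .coord (Sum.inr j)) _ z, fun v ↦ ?_⟩
      have hv : k.2 = sel (base (Set.inclusion ((hPS k).trans (hSN k.1)) v)) := by
        have h₁ := (hDmem k.1 k.2 (Set.inclusion (hPS k) v)).mp v.2.1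
        rcases lt_trichotomy k.2
          (sel (base (Set.inclusion ((hPS k).trans (hSN k.1)) v))) with h | h | h
        · exact absurd h₁ (hmin _ _ h)
        · exact h
        · exact absurd (Set.mem_iUnion.mpr ⟨(⟨_, h⟩ : {i // i < k.2}),
            (hDmem k.1 _ (Set.inclusion (hPS k) v)).mpr (hsel _)⟩) v.2.2
      rw [hαψ _ _ hv (g v) ((hg v).trans (hbase k.1 (Set.inclusion (hPS k) v)).symm), bundlePoint,
        projPoint_eq _ _ (hPS k v.2).2, chartPoint, Category.assoc]
  -- Equal points have equal images in the base, which gives the first vector and the same selected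
  -- frame; coordinates in that frame give the second.
  · have hb : base v = base w := by rw [← hα, ← hα, h]
    have hx := projPoint_injective ψ₀ v.2.1 w.2.1 hb
    have h' := hαψ w (sel (base v)) (congr_arg sel hb) (ψ (base v)) ((hψ _).trans hb)
    have hy := bundlePoint_injective v.2.2 w.2.2 (h.trans h')
    ext (i | i)
    · exact congr_fun hx i
    · exact congr_fun hy i
  · rw [← Category.assoc, hα, projPoint_toSpec]
  · rw [← Category.assoc] at hf
    obtain ⟨x, hx, hxf⟩ := exists_projPoint_eq ψ₀ _ hf
    obtain ⟨y, hy, hyf⟩ := exists_bundlePoint_eq (i := e (sel (projPoint ψ₀ hx)))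
      (ψ := ψ (projPoint ψ₀ hx)) f (hxf.symm.trans (hψ _).symm)
    exact ⟨⟨Sum.elim x y, hx, hy⟩, hyf⟩

end Parametrization

end
end ProjectiveBundle

/-! ### The main theorem -/

theorem mainTheorem9 {F : Type*} [Field F] (a₁ a₂ m₁ m₂ : ℕ)
    (ha₁ : 2 ≤ a₁) (ha₂ : 2 ≤ a₂) (hm₁ : 2 ≤ m₁) (hm₂ : 2 ≤ m₂)
    (V₁ : ProjectiveBundle.VectorBundle (ProjectiveBundle.projSpace a₁ (CommRingCat.of F)) m₁)
    (V₂ : ProjectiveBundle.VectorBundle (ProjectiveBundle.projSpace a₂ (CommRingCat.of F)) m₂)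
    (ha : a₁ ≠ a₂)
    (hiso : Nonempty
      (CategoryTheory.Over.mk (CategoryTheory.CategoryStruct.comp V₁.projToBase
          (ProjectiveBundle.projSpaceToSpec a₁ (CommRingCat.of F))) ≅
        CategoryTheory.Over.mk (CategoryTheory.CategoryStruct.comp V₂.projToBase
          (ProjectiveBundle.projSpaceToSpec a₂ (CommRingCat.of F))))) :
    m₁ = a₂ ∧ m₂ = a₁ := by
  open CategoryTheory AlgebraicGeometry ProjectiveBundle in
  obtain ⟨Φ⟩ := hiso
  let K := AlgebraicClosure F
  let _ : FirstOrder.Ring.CompatibleRing K := FirstOrder.Ring.compatibleRingOfRing K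
  let ψ : CommRingCat.of F ⟶ CommRingCat.of K := CommRingCat.ofHom (algebraMap F K)
  let φ : V₁.proj ⟶ V₂.proj := Φ.hom.left
  let φ' : V₂.proj ⟶ V₁.proj := Φ.inv.left
  have hφ : φ ≫ V₂.projToBase ≫ projSpaceToSpec a₂ _ =
      V₁.projToBase ≫ projSpaceToSpec a₁ _ := Over.w Φ.hom
  have hφ' : φ' ≫ V₁.projToBase ≫ projSpaceToSpec a₁ _ =
      V₂.projToBase ≫ projSpaceToSpec a₂ _ := Over.w Φ.inv
  have h₁ : φ ≫ φ' = 𝟙 _ := congr_arg CommaMorphism.left Φ.hom_inv_id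
  have h₂ : φ' ≫ φ = 𝟙 _ := congr_arg CommaMorphism.left Φ.inv_hom_id
  have : IsIso φ := ⟨φ', h₁, h₂⟩
  obtain ⟨α, hα, hαi, hαF, hαs⟩ := exists_parametrization ψ V₁
  obtain ⟨β, hβ, hβi, hβF, hβs⟩ := exists_parametrization ψ V₂
  have hG := definableSet_graph φ (V₁.projToBase ≫ projSpaceToSpec a₁ _)
    (V₂.projToBase ≫ projSpaceToSpec a₂ _) hφ hα hβ hαF hβF
  -- Composition with `φ` is a bijection on `K`-points over `ψ`, with inverse composition with `φ'`;
  -- the two parametrizations turn it into a bijection of normalized pairs.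
  refine eq_and_eq_of_definable_isBijGraph (by omega) (by omega) (by omega) (by omega) ha hG
    ⟨fun v hv ↦ ?_, fun w hw ↦ ?_⟩
  · obtain ⟨w, hw⟩ := hβs (α ⟨v, hv⟩ ≫ φ) (by rw [Category.assoc, hφ, hαF])
    refine ⟨w, ⟨w.2, hv, w.2, hw.symm⟩, fun w' ⟨h, _, _, e⟩ ↦ ?_⟩
    exact congr_arg Subtype.val (hβi (e.symm.trans hw.symm) : (⟨w', h⟩ : normalizedPairs _ _ K) = w)
  · obtain ⟨v, hv⟩ := hαs (β ⟨w, hw⟩ ≫ φ') (by rw [Category.assoc, hφ', hβF])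
    refine ⟨v, ⟨v.2, v.2, hw, ?_⟩, fun v' ⟨h, _, _, e⟩ ↦ ?_⟩
    · change α v ≫ φ = _
      rw [hv, Category.assoc, h₂, Category.comp_id]
      rfl
    · have : α ⟨v', h⟩ = α v := by
        rw [← cancel_mono φ, hv, Category.assoc, h₂, Category.comp_id]
        exact e
      exact congr_arg Subtype.val (hαi this)
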